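/- **Conventions.** Let $k$ be a field of characteristic $p>2$ and $\mathfrak g$ a $2$-dimensional Lie algebra over $k$. The enveloping algebra $U(\mathfrak g)$ is a Hopf algebra in which the elements of $\mathfrak g$ are primitive; $\hat{\mathfrak g}\subseteq U(\mathfrak g)$ is the span of all $v^{p^r}$ with $v\in\mathfrak g$, $r\ge 0$; $[s,t]=st-ts$ in $U(\mathfrak g)$. For a Hopf algebra $A$, an algebra endomorphism $\tau$ of $A$ and a $\tau$-derivation $\delta$ (so $\delta(st)=\tau(s)\delta(t)+\delta(s)t$), the Ore extension $A[z;\tau,\delta]$ is the algebra that is free as a left $A$-module on $1,z,z^2,\dots$, with $zs=\tau(s)z+\delta(s)$ for $s\in A$. A *generalized Hopf-Ore extension* of $A$, determined by $r_1,r_2,x,y\in A$, is a Hopf algebra structure on $H=A[z;\tau,\delta]$ such that $A$ is a Hopf subalgebra and $\Delta z=z\otimes r_1+x\otimes y+r_2\otimes z$. If moreover $r_1,r_2$ are group-like, $\Delta x=x\otimes 1+r_2\otimes x$, $\Delta y=y\otimes r_1+1\otimes y$, $x=0\Leftrightarrow y=0$, and $\tau(s)=\sum\chi(s_1)\,\mathrm{Ad}_{r_1}(s_2)$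 for a character (algebra map) $\chi:A\to k$, where $\mathrm{Ad}_s(t)=\sum s_1tS(s_2)$, we write $H=A(\chi,r_1,r_2,x,y,\delta)$; for $A=U(\mathfrak g)$ we write $\chi=0$ if $\chi$ vanishes on $\mathfrak g$. Two generalized Hopf-Ore extensions $H$ of $A$ and $H'$ of $A'$ are isomorphic if there is a Hopf algebra isomorphism $H\to H'$ that takes $A$ onto $A'$. **Proposition.** There is a basis $a,b$ of $\mathfrak g$ with $[a,b]=0$ or $[a,b]=a$. Let $H$ be a generalized Hopf-Ore extension of $U(\mathfrak g)$ determined by $r_1,r_2,x,y$. Then $r_1=r_2=1$. If $\Delta x=x\otimes 1+r_2\otimes x$ and $\Delta y=y\otimes r_1+1\otimes y$, then $x,y\in\hat{\mathfrak g}$, and for every basis $a,b$ as above they can be written uniquely as $x=\sum_i\alpha_ia^{p^i}+\sum_i\alpha_i'b^{p^i}$, $y=\sum_i\beta_ia^{p^i}+\sum_i\beta'_ib^{p^i}$ (finite sums, coefficients in $k$). In such expansions put $\alpha'=-\sum_i\alpha'_i$ and $\beta'=-\sum_i\beta_i'$. For every basis $a,b$ of $\mathfrak g$ with $[a,b]=0$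 or $[a,b]=a$, $H$ is isomorphic, as a generalized Hopf-Ore extension, to one of the following, where $x,y$ now denote the elements in the new data and $\alpha_i,\alpha'_i,\beta_i,\beta'_i$ their coefficients: (a) $U(\mathfrak g)(\chi,1,1,0,0,\delta)$ with $[a,b]=0$ or $[a,b]=a$, where $\chi$ is a character, $\delta(\mathfrak g)\subseteq\hat{\mathfrak g}$ and $\delta([a,b])=[\delta(a),b]+[a,\delta(b)]+\chi(a)\delta(b)-\chi(b)\delta(a)$. (b) $U(\mathfrak g)(0,1,1,x,y,\delta)$ with $[a,b]=0$, $0\ne x,y\in\hat{\mathfrak g}$, $kx\ne ky$ and $\delta(\mathfrak g)\subseteq\hat{\mathfrak g}$. (c) $U(\mathfrak g)(0,1,1,x,y,\delta)$ with $[a,b]=a$, $0\ne x,y\in\hat{\mathfrak g}$, $kx\ne ky$, $\alpha_0=\beta_0=\alpha'=\beta'=0$, $\delta(\mathfrak g)\subseteq\hat{\mathfrak g}$ and $\delta(a)=[\delta(a),b]+[a,\delta(b)]$. (d) $U(\mathfrak g)(\chi,1,1,x,y,\delta)$ with $[a,b]=a$, $\chi(a)=0$, $\chi(b)=1$, $0\ne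 x,y\in\hat{\mathfrak g}$, $kx\ne ky$, $2\delta(a)=[\delta(a),b]+[a,\delta(b)]$, and one of: (i) $x=\alpha_0a$, and $\delta(a)-\frac12\alpha_0\beta'a^2,\ \delta(b)-\frac12\alpha_0\beta_0a^2\in\hat{\mathfrak g}$; (ii) $y=\beta_0a$, and $\delta(a)-\frac12\alpha'\beta_0a^2,\ \delta(b)-\frac12\alpha_0\beta_0a^2\in\hat{\mathfrak g}$; (iii) $\alpha'=0$, $y-\beta_0a=\lambda(x-\alpha_0a)\ne0$ for some $\lambda\in k\setminus\{0\}$, and $\delta(a)\in\hat{\mathfrak g}$, $\delta(b)+\frac12(xy-\beta_0xa-\alpha_0ay)\in\hat{\mathfrak g}$. Up to isomorphism of Hopf algebras, the Hopf algebras in (a) with $\delta(\mathfrak g)\subseteq\mathfrak g$ are exactly the enveloping algebras of the $3$-dimensional Lie algebras over $k$ that have a $2$-dimensional Lie subalgebra: each such Hopf algebra is isomorphic to $U(M)$ for such a Lie algebra $M$, and for each such $M$ and each $2$-dimensional Lie subalgebra $N\subseteq M$, $U(M)$ is itself, for some $z\in U(M)$, an extension of $U(N)$ of type (a) with $\delta(N)\subseteq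 N$. -/

import Mathlib

open scoped TensorProduct

universe u v w

namespace HopfOre

noncomputable section

/-! ## The Hopf algebra structure on an enveloping algebra: elements of `L` are primitive -/

section Enveloping

attribute [local instance 100] LieRing.ofAssociativeRing

variable (k : Type u) [Field k] (L : Type v) [LieRing L] [LieAlgebra k L]

/-- The Lie homomorphism `v ↦ v ⊗ 1 + 1 ⊗ v`. -/
def primitiveLieHom :
    L →ₗ⁅k⁆ UniversalEnvelopingAlgebra k L ⊗[k] UniversalEnvelopingAlgebra k L where
  toFun v := UniversalEnvelopingAlgebra.ι k v ⊗ₜ[k] 1 + 1 ⊗ₜ[k] UniversalEnvelopingAlgebra.ι k v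
  map_add' v w := by
    simp only [map_add, TensorProduct.add_tmul, TensorProduct.tmul_add]; abel
  map_smul' c v := by
    simp only [map_smul, TensorProduct.smul_tmul', TensorProduct.tmul_smul, smul_add,
      RingHom.id_apply]
  map_lie' {v w} := by
    simp only [LieHom.map_lie, LieRing.of_associative_ring_bracket, mul_add, add_mul,
      Algebra.TensorProduct.tmul_mul_tmul, mul_one, one_mul, TensorProduct.sub_tmul,
      TensorProduct.tmul_sub]
    abel

/-- The comultiplication of `U(L)`. -/
def envComul : UniversalEnvelopingAlgebra k L →ₐ[k]
    UniversalEnvelopingAlgebra k L ⊗[k] UniversalEnvelopingAlgebra k L :=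
  UniversalEnvelopingAlgebra.lift k (primitiveLieHom k L)

/-- The counit of `U(L)`. -/
def envCounit : UniversalEnvelopingAlgebra k L →ₐ[k] k :=
  UniversalEnvelopingAlgebra.lift k (0 : L →ₗ⁅k⁆ k)

/-- The Lie homomorphism `v ↦ -v` into the opposite algebra. -/
def negLieHom : L →ₗ⁅k⁆ (UniversalEnvelopingAlgebra k L)ᵐᵒᵖ where
  toFun v := MulOpposite.op (-UniversalEnvelopingAlgebra.ι k v)
  map_add' v w := by
    rw [map_add, neg_add, MulOpposite.op_add]
  map_smul' c v := by
    rw [map_smul, ← smul_neg, MulOpposite.op_smul]; rfl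
  map_lie' {v w} := by
    apply MulOpposite.unop_injective
    simp only [LieHom.map_lie, LieRing.of_associative_ring_bracket, MulOpposite.unop_op,
      MulOpposite.unop_sub, MulOpposite.unop_mul, neg_mul_neg, neg_sub]

/-- The antipode of `U(L)`: the anti-homomorphism with `v ↦ -v` for `v ∈ L`. -/
def envAntipode : UniversalEnvelopingAlgebra k L →ₗ[k] UniversalEnvelopingAlgebra k L :=
  (MulOpposite.opLinearEquiv k).symm.toLinearMap ∘ₗ
    (UniversalEnvelopingAlgebra.lift k (negLieHom k L)).toLinearMap

variable {L}

theorem envComul_ι (v : L) : envComul k L (UniversalEnvelopingAlgebra.ι k v) =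
    UniversalEnvelopingAlgebra.ι k v ⊗ₜ[k] 1 + 1 ⊗ₜ[k] UniversalEnvelopingAlgebra.ι k v :=
  UniversalEnvelopingAlgebra.lift_ι_apply k _ v

theorem envCounit_ι (v : L) : envCounit k L (UniversalEnvelopingAlgebra.ι k v) = 0 :=
  UniversalEnvelopingAlgebra.lift_ι_apply k _ v

theorem envAntipode_ι (v : L) : envAntipode k L (UniversalEnvelopingAlgebra.ι k v) =
    -UniversalEnvelopingAlgebra.ι k v := by
  simp only [envAntipode, LinearMap.comp_apply, AlgHom.toLinearMap_apply,
    UniversalEnvelopingAlgebra.lift_ι_apply]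
  rfl

theorem envAntipode_one : envAntipode k L 1 = 1 := by
  simp [envAntipode]

theorem envAntipode_mul (s t : UniversalEnvelopingAlgebra k L) :
    envAntipode k L (s * t) = envAntipode k L t * envAntipode k L s := by
  simp [envAntipode]

theorem env_hom_ext {B : Type w} [Ring B] [Algebra k B]
    {f g : UniversalEnvelopingAlgebra k L →ₐ[k] B}
    (h : ∀ v : L, f (UniversalEnvelopingAlgebra.ι k v) = g (UniversalEnvelopingAlgebra.ι k v)) :
    f = g :=
  UniversalEnvelopingAlgebra.hom_ext k (LieHom.ext h)

/-- A subalgebra of `U(L)` that contains `L` is everything. -/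
theorem mem_of_ι_mem (S : Subalgebra k (UniversalEnvelopingAlgebra k L))
    (hS : ∀ v : L, UniversalEnvelopingAlgebra.ι k v ∈ S) (t : UniversalEnvelopingAlgebra k L) :
    t ∈ S := by
  let f : L →ₗ⁅k⁆ S :=
    { toFun := fun v => ⟨UniversalEnvelopingAlgebra.ι k v, hS v⟩
      map_add' := fun v w => Subtype.ext (map_add _ v w)
      map_smul' := fun c v => Subtype.ext (map_smul _ c v)
      map_lie' := fun {v w} => Subtype.ext (by
        simp [LieRing.of_associative_ring_bracket]) }
  have h : S.val.comp (UniversalEnvelopingAlgebra.lift k f) = AlgHom.id k _ := by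
    apply UniversalEnvelopingAlgebra.hom_ext
    ext v
    change ((UniversalEnvelopingAlgebra.lift k f (UniversalEnvelopingAlgebra.ι k v) : S) :
      UniversalEnvelopingAlgebra k L) = UniversalEnvelopingAlgebra.ι k v
    rw [UniversalEnvelopingAlgebra.lift_ι_apply]
    rfl
  have h2 : ((UniversalEnvelopingAlgebra.lift k f t : S) : UniversalEnvelopingAlgebra k L) = t :=
    congrArg (fun F : UniversalEnvelopingAlgebra k L →ₐ[k] UniversalEnvelopingAlgebra k L => F t) h
  rw [← h2]
  exact Subtype.property _

variable (L)

instance instBialgebraEnveloping : Bialgebra k (UniversalEnvelopingAlgebra k L) :=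
  Bialgebra.ofAlgHom (envComul k L) (envCounit k L)
    (by
      refine env_hom_ext k fun v => ?_
      change Algebra.TensorProduct.assoc k k k _ _ _ (Algebra.TensorProduct.map _ _
        (envComul k L (UniversalEnvelopingAlgebra.ι k v))) = Algebra.TensorProduct.map _ _
        (envComul k L (UniversalEnvelopingAlgebra.ι k v))
      simp only [envComul_ι, map_add, Algebra.TensorProduct.map_tmul, map_one, AlgHom.id_apply,
        TensorProduct.add_tmul, TensorProduct.tmul_add, Algebra.TensorProduct.one_def,
        Algebra.TensorProduct.assoc_tmul]
      abel)
    (by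
      refine env_hom_ext k fun v => ?_
      change Algebra.TensorProduct.map _ _ (envComul k L (UniversalEnvelopingAlgebra.ι k v)) =
        (1 : k) ⊗ₜ[k] UniversalEnvelopingAlgebra.ι k v
      simp [-UniversalEnvelopingAlgebra.ι_apply, envComul_ι, envCounit_ι])
    (by
      refine env_hom_ext k fun v => ?_
      change Algebra.TensorProduct.map _ _ (envComul k L (UniversalEnvelopingAlgebra.ι k v)) =
        UniversalEnvelopingAlgebra.ι k v ⊗ₜ[k] (1 : k)
      simp [-UniversalEnvelopingAlgebra.ι_apply, envComul_ι, envCounit_ι])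

/-- `s ⊗ t ↦ S(s) t`. -/
def leftFold : UniversalEnvelopingAlgebra k L ⊗[k] UniversalEnvelopingAlgebra k L →ₗ[k]
    UniversalEnvelopingAlgebra k L :=
  LinearMap.mul' k _ ∘ₗ (envAntipode k L).rTensor _

/-- `s ⊗ t ↦ s S(t)`. -/
def rightFold : UniversalEnvelopingAlgebra k L ⊗[k] UniversalEnvelopingAlgebra k L →ₗ[k]
    UniversalEnvelopingAlgebra k L :=
  LinearMap.mul' k _ ∘ₗ (envAntipode k L).lTensor _

variable {L}

theorem leftFold_tmul (s t : UniversalEnvelopingAlgebra k L) :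
    leftFold k L (s ⊗ₜ t) = envAntipode k L s * t := by simp [leftFold]

theorem rightFold_tmul (s t : UniversalEnvelopingAlgebra k L) :
    rightFold k L (s ⊗ₜ t) = s * envAntipode k L t := by simp [rightFold]

theorem leftFold_mul (x y : UniversalEnvelopingAlgebra k L ⊗[k] UniversalEnvelopingAlgebra k L)
    (c : k) (hx : leftFold k L x = algebraMap k _ c) :
    leftFold k L (x * y) = c • leftFold k L y := by
  induction y using TensorProduct.induction_on with
  | zero => simp
  | add y₁ y₂ h₁ h₂ => simp only [mul_add, map_add, h₁, h₂, smul_add]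
  | tmul s t =>
    have key : ∀ x, leftFold k L (x * s ⊗ₜ[k] t) = envAntipode k L s * leftFold k L x * t := by
      intro x
      induction x using TensorProduct.induction_on with
      | zero => simp
      | add x₁ x₂ h₁ h₂ => simp only [mul_add, add_mul, map_add, h₁, h₂]
      | tmul s' t' =>
        simp only [Algebra.TensorProduct.tmul_mul_tmul, leftFold_tmul, envAntipode_mul, mul_assoc]
    rw [key, hx, leftFold_tmul, ← Algebra.commutes, mul_assoc, ← Algebra.smul_def]

theorem rightFold_mul (x y : UniversalEnvelopingAlgebra k L ⊗[k] UniversalEnvelopingAlgebra k L)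
    (c : k) (hy : rightFold k L y = algebraMap k _ c) :
    rightFold k L (x * y) = c • rightFold k L x := by
  induction x using TensorProduct.induction_on with
  | zero => simp
  | add y₁ y₂ h₁ h₂ => simp only [add_mul, map_add, h₁, h₂, smul_add]
  | tmul s t =>
    have key : ∀ y, rightFold k L (s ⊗ₜ[k] t * y) = s * rightFold k L y * envAntipode k L t := by
      intro y
      induction y using TensorProduct.induction_on with
      | zero => simp
      | add x₁ x₂ h₁ h₂ => simp only [mul_add, add_mul, map_add, h₁, h₂]
      | tmul s' t' =>
        simp only [Algebra.TensorProduct.tmul_mul_tmul, rightFold_tmul, envAntipode_mul, mul_assoc]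
    rw [key, hy, rightFold_tmul, ← Algebra.commutes, mul_assoc, ← Algebra.smul_def]

theorem leftFold_comul (t : UniversalEnvelopingAlgebra k L) :
    leftFold k L (envComul k L t) = algebraMap k _ (envCounit k L t) := by
  let S : Subalgebra k (UniversalEnvelopingAlgebra k L) :=
    { carrier := {t | leftFold k L (envComul k L t) = algebraMap k _ (envCounit k L t)}
      mul_mem' := by
        intro s t hs ht
        simp only [Set.mem_ofPred_eq] at hs ht ⊢
        rw [map_mul, leftFold_mul k _ _ _ hs, ht, map_mul, map_mul, Algebra.smul_def]
      add_mem' := by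
        intro s t hs ht
        simp only [Set.mem_ofPred_eq] at hs ht ⊢
        simp only [map_add, hs, ht]
      algebraMap_mem' := by
        intro c
        simp only [Set.mem_ofPred_eq, AlgHom.commutes, Algebra.TensorProduct.algebraMap_apply,
          leftFold_tmul, mul_one, Algebra.algebraMap_self_apply]
        rw [Algebra.algebraMap_eq_smul_one, map_smul, envAntipode_one] }
  refine mem_of_ι_mem k S (fun v => ?_) t
  change leftFold k L (envComul k L _) = algebraMap k _ (envCounit k L _)
  simp [-UniversalEnvelopingAlgebra.ι_apply, envComul_ι, envCounit_ι, leftFold_tmul,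
    envAntipode_ι, envAntipode_one]

theorem rightFold_comul (t : UniversalEnvelopingAlgebra k L) :
    rightFold k L (envComul k L t) = algebraMap k _ (envCounit k L t) := by
  let S : Subalgebra k (UniversalEnvelopingAlgebra k L) :=
    { carrier := {t | rightFold k L (envComul k L t) = algebraMap k _ (envCounit k L t)}
      mul_mem' := by
        intro s t hs ht
        simp only [Set.mem_ofPred_eq] at hs ht ⊢
        rw [map_mul, rightFold_mul k _ _ _ ht, hs, map_mul, map_mul, Algebra.smul_def,
          Algebra.commutes]
      add_mem' := by
        intro s t hs ht
        simp only [Set.mem_ofPred_eq] at hs ht ⊢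
        simp only [map_add, hs, ht]
      algebraMap_mem' := by
        intro c
        simp only [Set.mem_ofPred_eq, AlgHom.commutes, Algebra.TensorProduct.algebraMap_apply,
          rightFold_tmul, envAntipode_one, mul_one, Algebra.algebraMap_self_apply] }
  refine mem_of_ι_mem k S (fun v => ?_) t
  change rightFold k L (envComul k L _) = algebraMap k _ (envCounit k L _)
  simp [-UniversalEnvelopingAlgebra.ι_apply, envComul_ι, envCounit_ι, rightFold_tmul,
    envAntipode_ι, envAntipode_one]

variable (L)

/-- `U(L)` as a Hopf algebra, the elements of `L` being primitive. -/
instance instHopfAlgebraEnveloping : HopfAlgebra k (UniversalEnvelopingAlgebra k L) where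
  antipode := envAntipode k L
  mul_antipode_rTensor_comul := LinearMap.ext (leftFold_comul k)
  mul_antipode_lTensor_comul := LinearMap.ext (rightFold_comul k)

/-- The Hopf algebra homomorphism `U(M) → U(L)` induced by the inclusion of a Lie subalgebra. -/
def envIncl (M : LieSubalgebra k L) :
    UniversalEnvelopingAlgebra k M →ₐc[k] UniversalEnvelopingAlgebra k L :=
  BialgHom.ofAlgHom
    (UniversalEnvelopingAlgebra.lift k ((UniversalEnvelopingAlgebra.ι k).comp M.incl))
    (by
      refine env_hom_ext k fun v => ?_
      change envCounit k L (UniversalEnvelopingAlgebra.lift k _ (UniversalEnvelopingAlgebra.ι k v))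
        = envCounit k M (UniversalEnvelopingAlgebra.ι k v)
      rw [UniversalEnvelopingAlgebra.lift_ι_apply, envCounit_ι]
      exact envCounit_ι k _)
    (by
      refine env_hom_ext k fun v => ?_
      change Algebra.TensorProduct.map _ _ (envComul k M (UniversalEnvelopingAlgebra.ι k v)) =
        envComul k L (UniversalEnvelopingAlgebra.lift k _ (UniversalEnvelopingAlgebra.ι k v))
      rw [envComul_ι, UniversalEnvelopingAlgebra.lift_ι_apply]
      simp only [map_add, Algebra.TensorProduct.map_tmul, map_one]
      rw [UniversalEnvelopingAlgebra.lift_ι_apply]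
      exact (envComul_ι k _).symm)

end Enveloping

/-! ## Generalized Hopf-Ore extensions -/

section Extensions

variable {k : Type u} [Field k]

/-- The algebra `H` with the embedding `i` of `A` and the element `z` is the Ore extension
`A[z; τ, δ]`: `δ` is a `τ`-derivation, `z a = τ(a) z + δ(a)` holds in `H`, and every element of `H`
is `∑ aₙ zⁿ` for exactly one finitely supported family `(aₙ)` in `A` (so `i` is injective). -/
structure IsOreExtension {A : Type v} [Ring A] [Algebra k A] {H : Type w} [Ring H] [Algebra k H]
    (τ : A →ₐ[k] A) (δ : A →ₗ[k] A) (i : A →ₐ[k] H) (z : H) : Prop where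
  derivation : ∀ a b : A, δ (a * b) = τ a * δ b + δ a * b
  relation : ∀ a : A, z * i a = i (τ a) * z + i (δ a)
  basis : Function.Bijective fun f : ℕ →₀ A => f.sum fun n a => i a * z ^ n

variable {A : Type v} [Ring A] [HopfAlgebra k A] {H : Type w} [Ring H] [HopfAlgebra k H]

/-- The Hopf algebra `H` is the Ore extension `A[z; τ, δ]`, it contains `A` as a Hopf subalgebra
(through the bialgebra homomorphism `i`, which respects antipodes automatically), and
`Δ z = z ⊗ r₁ + x ⊗ y + r₂ ⊗ z`. -/
structure IsGeneralizedHopfOre (τ : A →ₐ[k] A) (δ : A →ₗ[k] A) (r₁ r₂ x y : A)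
    (i : A →ₐc[k] H) (z : H) : Prop where
  ore : IsOreExtension τ δ (i : A →ₐ[k] H) z
  comul_z : Coalgebra.comul (R := k) z = z ⊗ₜ[k] i r₁ + i x ⊗ₜ[k] i y + i r₂ ⊗ₜ[k] z

variable (k) in
/-- `x` is `(g, h)`-primitive: `Δ x = x ⊗ g + h ⊗ x`. -/
def IsSkewPrimitive (g h x : A) : Prop :=
  Coalgebra.comul (R := k) x = x ⊗ₜ[k] g + h ⊗ₜ[k] x

/-- `Ad_a(b) = ∑ a₁ b S(a₂)`, as a linear map in `b`. -/
def Ad (a : A) : A →ₗ[k] A :=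
  (TensorProduct.lift ((LinearMap.llcomp k A A A).flip.compl₁₂
    (LinearMap.mul k A) ((LinearMap.mul k A).flip ∘ₗ HopfAlgebra.antipode k)))
    (Coalgebra.comul (R := k) a)

/-- The map `a ↦ ∑ χ(a₁) Ad_r(a₂)`. -/
def twist (χ : A →ₐ[k] k) (r : A) : A →ₗ[k] A :=
  TensorProduct.lift ((LinearMap.lsmul k A).comp χ.toLinearMap |>.compl₂ (Ad (k := k) r)) ∘ₗ
    Coalgebra.comul

/-- `H`, with the embedding `i` and the element `z`, is the generalized Hopf-Ore extension in normal
form `A(χ, r₁, r₂, x, y, δ)`: `τ(a) = ∑ χ(a₁) Ad_{r₁}(a₂)`, the elements `r₁`, `r₂` are group-like,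
`x` is `(1, r₂)`-primitive, `y` is `(r₁, 1)`-primitive, and `x = 0` if and only if `y = 0`. -/
structure IsNormalHopfOre (χ : A →ₐ[k] k) (r₁ r₂ x y : A) (δ : A →ₗ[k] A)
    (i : A →ₐc[k] H) (z : H) : Prop where
  extension : ∃ τ : A →ₐ[k] A, τ.toLinearMap = twist χ r₁ ∧ IsGeneralizedHopfOre τ δ r₁ r₂ x y i z
  groupLike₁ : IsGroupLikeElem k r₁
  groupLike₂ : IsGroupLikeElem k r₂
  primitive_x : IsSkewPrimitive k 1 r₂ x
  primitive_y : IsSkewPrimitive k r₁ 1 y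
  zero_iff : x = 0 ↔ y = 0

/-- Isomorphism of generalized Hopf-Ore extensions `A ⊆ H` and `A' ⊆ H'`: an isomorphism of Hopf
algebras `H → H'` that takes `A` onto `A'`. -/
def ExtensionIso {A' : Type*} [Ring A'] [HopfAlgebra k A'] {H' : Type*} [Ring H']
    [HopfAlgebra k H'] (i : A →ₐc[k] H) (i' : A' →ₐc[k] H') : Prop :=
  ∃ Ψ : H ≃ₐc[k] H', Ψ '' Set.range i = Set.range i'

end Extensions

/-! ## The four families -/

section Families

variable {k : Type u} [Field k] {L : Type v} [LieRing L] [LieAlgebra k L]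

/-- The commutator `s t - t s`. -/
def opComm {R : Type*} [Ring R] (s t : R) : R := s * t - t * s

/-- The span of all `v ^ (p ^ r)` with `v ∈ L`, `r ≥ 0`, inside `U(L)`. -/
def hatL (p : ℕ) (k : Type u) [Field k] (L : Type v) [LieRing L] [LieAlgebra k L] :
    Submodule k (UniversalEnvelopingAlgebra k L) :=
  Submodule.span k {t | ∃ (v : L) (r : ℕ), t = UniversalEnvelopingAlgebra.ι k v ^ p ^ r}

/-- `∑ αᵢ a ^ (p ^ i) + ∑ α'ᵢ b ^ (p ^ i)` in `U(L)`, for `a`, `b` in `L`. -/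
def pSum (p : ℕ) (a b : L) (α α' : ℕ →₀ k) : UniversalEnvelopingAlgebra k L :=
  (α.sum fun n c => c • UniversalEnvelopingAlgebra.ι k a ^ p ^ n) +
    α'.sum fun n c => c • UniversalEnvelopingAlgebra.ι k b ^ p ^ n

/-- `-∑ α'ᵢ`. -/
def negSum (α' : ℕ →₀ k) : k := -α'.sum fun _ c => c

/-- The basis `a = e 0`, `b = e 1` satisfies `[a, b] = 0` or `[a, b] = a`. -/
def IsNormalBasis (e : Module.Basis (Fin 2) k L) : Prop :=
  ⁅e 0, e 1⁆ = 0 ∨ ⁅e 0, e 1⁆ = e 0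

variable (p : ℕ) (e : Module.Basis (Fin 2) k L)
  (χ : UniversalEnvelopingAlgebra k L →ₐ[k] k) (x y : UniversalEnvelopingAlgebra k L)
  (δ : UniversalEnvelopingAlgebra k L →ₗ[k] UniversalEnvelopingAlgebra k L)

/-- Family (a). -/
def FamilyA : Prop :=
  let a := UniversalEnvelopingAlgebra.ι k (e 0)
  let b := UniversalEnvelopingAlgebra.ι k (e 1)
  IsNormalBasis e ∧ x = 0 ∧ y = 0 ∧
  (∀ v : L, δ (UniversalEnvelopingAlgebra.ι k v) ∈ hatL p k L) ∧
  δ (UniversalEnvelopingAlgebra.ι k ⁅e 0, e 1⁆) =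
    opComm (δ a) b + opComm a (δ b) + χ a • δ b - χ b • δ a

/-- Family (b). The character is the trivial one: it vanishes on `L`. -/
def FamilyB : Prop :=
  ⁅e 0, e 1⁆ = 0 ∧
  (∀ v : L, χ (UniversalEnvelopingAlgebra.ι k v) = 0) ∧
  x ∈ hatL p k L ∧ y ∈ hatL p k L ∧ x ≠ 0 ∧ y ≠ 0 ∧ Submodule.span k {x} ≠ Submodule.span k {y} ∧
  ∀ v : L, δ (UniversalEnvelopingAlgebra.ι k v) ∈ hatL p k L

/-- Family (c). -/
def FamilyC : Prop :=
  let a := UniversalEnvelopingAlgebra.ι k (e 0)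
  let b := UniversalEnvelopingAlgebra.ι k (e 1)
  ⁅e 0, e 1⁆ = e 0 ∧
  (∀ v : L, χ (UniversalEnvelopingAlgebra.ι k v) = 0) ∧
  x ≠ 0 ∧ y ≠ 0 ∧ Submodule.span k {x} ≠ Submodule.span k {y} ∧
  (∃ α α' β β' : ℕ →₀ k, x = pSum p (e 0) (e 1) α α' ∧ y = pSum p (e 0) (e 1) β β' ∧
    α 0 = 0 ∧ β 0 = 0 ∧ negSum α' = 0 ∧ negSum β' = 0) ∧
  (∀ v : L, δ (UniversalEnvelopingAlgebra.ι k v) ∈ hatL p k L) ∧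
  δ a = opComm (δ a) b + opComm a (δ b)

/-- Family (d), with its three cases (i), (ii), (iii). -/
def FamilyD : Prop :=
  let a := UniversalEnvelopingAlgebra.ι k (e 0)
  let b := UniversalEnvelopingAlgebra.ι k (e 1)
  ⁅e 0, e 1⁆ = e 0 ∧ χ a = 0 ∧ χ b = 1 ∧
  x ≠ 0 ∧ y ≠ 0 ∧ Submodule.span k {x} ≠ Submodule.span k {y} ∧
  (2 : k) • δ a = opComm (δ a) b + opComm a (δ b) ∧
  ∃ α α' β β' : ℕ →₀ k, x = pSum p (e 0) (e 1) α α' ∧ y = pSum p (e 0) (e 1) β β' ∧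
    ((x = α 0 • a ∧
        δ a - (2⁻¹ * α 0 * negSum β') • a ^ 2 ∈ hatL p k L ∧
        δ b - (2⁻¹ * α 0 * β 0) • a ^ 2 ∈ hatL p k L) ∨
      (y = β 0 • a ∧
        δ a - (2⁻¹ * negSum α' * β 0) • a ^ 2 ∈ hatL p k L ∧
        δ b - (2⁻¹ * α 0 * β 0) • a ^ 2 ∈ hatL p k L) ∨
      (negSum α' = 0 ∧
        (∃ c : k, c ≠ 0 ∧ y - β 0 • a = c • (x - α 0 • a) ∧ y - β 0 • a ≠ 0) ∧
        δ a ∈ hatL p k L ∧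
        δ b + (2⁻¹ : k) • (x * y - β 0 • (x * a) - α 0 • (a * y)) ∈ hatL p k L))

/-- The data `χ`, `x`, `y`, `δ` belong to one of the four families, relative to the basis `e`. -/
def InList : Prop :=
  FamilyA p e χ x y δ ∨ FamilyB p e χ x y δ ∨ FamilyC p e χ x y δ ∨ FamilyD p e χ x y δ

end Families

end

end HopfOre

open HopfOre

namespace HopfOre

noncomputable section

open UniversalEnvelopingAlgebra (ι)

attribute [local instance 100] LieRing.ofAssociativeRing

/-! ### Enveloping algebras: generators, brackets and homomorphisms -/

section EnvelopingGeneral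

variable {k : Type u} [Field k] {L : Type v} [LieRing L] [LieAlgebra k L]

/-! The engine is the basis `bʲ aⁱ` of `U(L)`, on which the comultiplication is given by binomial
coefficients. Comparing coordinates of `Δu` (`coord_tmul_coord_comul`) shows that `1` is the only
nonzero `r` with `Δr = r ⊗ r`, and that in characteristic `p` the primitive elements are the
combinations of the `a ^ p ^ i` and `b ^ p ^ i` (`exists_eq_pSum`). Writing `[a, b] = ε a` treats `ε
= 0` and `ε = 1` together.

Let `H` be an extension. Extracting coefficients of powers of `z` from coassociativity at `z` makes
`r₁` and `r₂` group-like, hence `1`, and leaves one relation between `Δx` and `Δy`; it forces `x`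
and `y` to be primitive or `x ⊗ y` to be a scalar (`primitive_or_scalar`). Applying `Δ` to `z s =
τ(s) z + δ(s)` with `s` primitive gives `τ(s) = s + χ(s)`, where `χ` is the counit after `τ`, and
shows that `δ(s)` is primitive up to the defect `[x, s] ⊗ y + x ⊗ [y, s] - χ(s) x ⊗ y`. Since `U(L)`
is cocommutative, this defect is a symmetric tensor (`symmetric`).

Replacing `z` by `z + u` alters `x ⊗ y` by the non-primitive part of `Δu` and does not touch `U(L) ⊆
H`, so the isomorphisms of the classification can all be identity maps. A scalar `x ⊗ y`, or
proportional `x` and `y`, can be removed altogether, which gives (a). For independent `x`, `y` and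
abelian `L`, symmetry of the defect forces `χ = 0`, which gives (b). If `[a, b] = a`, the brackets
of `x` and `y` with `a` and `b` are multiples of `a`, and symmetry leaves only `χ(b) = 0`, which
gives (c), and `χ(b) = 1`. In the last case a quadratic `u` achieves `y = a` with `x` free of `a`,
so that case (ii) of (d) already suffices.

For `δ(L) ⊆ L` in (a), the space `L + k z` is a Lie algebra of primitive elements whose enveloping
algebra is `H` (`exists_enveloping`). Conversely, for `N ⊆ M` of codimension one, bracketing with a
complementary vector produces `χ` and `δ`, and `U(M)` acts on polynomials in `z` over `U(N)`, which
proves the Ore basis property (`enveloping_isNormalHopfOre`). -/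

theorem ι_mul_sub (v w : L) : ι k v * ι k w - ι k w * ι k v = ι k ⁅v, w⁆ := by
  rw [LieHom.map_lie, LieRing.of_associative_ring_bracket]

/-- A left ideal of `U(L)` that contains `1` is everything, where stability under left
multiplication needs to be checked on `L` only. -/
theorem mem_of_left_stable (S : Submodule k (UniversalEnvelopingAlgebra k L)) (h1 : 1 ∈ S)
    (hS : ∀ v : L, ∀ s ∈ S, ι k v * s ∈ S) (t : UniversalEnvelopingAlgebra k L) : t ∈ S := by
  let T : Subalgebra k (UniversalEnvelopingAlgebra k L) :=
    { carrier := {t | ∀ s ∈ S, t * s ∈ S}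
      mul_mem' := fun {t t'} ht ht' s hs => by
        rw [mul_assoc]; exact ht _ (ht' _ hs)
      add_mem' := fun {t t'} ht ht' s hs => by
        rw [add_mul]; exact S.add_mem (ht _ hs) (ht' _ hs)
      algebraMap_mem' := fun c s hs => by
        rw [← Algebra.smul_def]; exact S.smul_mem c hs }
  have h : t ∈ T := mem_of_ι_mem k T (fun v s hs => hS v s hs) t
  simpa using h 1 h1

/-- In a Lie algebra with basis `a, b`, every bracket is a multiple of `[a, b]`. -/
theorem lie_eq_smul_lie (e : Module.Basis (Fin 2) k L) (v w : L) :
    ⁅v, w⁆ = (e.repr v 0 * e.repr w 1 - e.repr v 1 * e.repr w 0) • ⁅e 0, e 1⁆ := by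
  conv_lhs => rw [← e.sum_repr v, ← e.sum_repr w]
  simp only [Fin.sum_univ_two, add_lie, lie_add, smul_lie, lie_smul, lie_self, smul_zero, zero_add,
    add_zero]
  rw [← lie_skew (e 0) (e 1)]
  module

/-- The homomorphism from `U(L)` given by two elements that satisfy the relation
`AB - BA = εA` of the basis of `L`. -/
def liftOfBasis {R : Type*} [Ring R] [Algebra k R] (e : Module.Basis (Fin 2) k L) {ε : k}
    (he : ⁅e 0, e 1⁆ = ε • e 0) (A B : R) (h : A * B - B * A = ε • A) :
    UniversalEnvelopingAlgebra k L →ₐ[k] R :=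
  UniversalEnvelopingAlgebra.lift k
    { e.constr k ![A, B] with
      map_lie' := fun {v w} => by
        change e.constr k ![A, B] ⁅v, w⁆ = ⁅e.constr k ![A, B] v, e.constr k ![A, B] w⁆
        rw [lie_eq_smul_lie e, he, map_smul, map_smul, e.constr_basis, Module.Basis.constr_apply_fintype,
          Module.Basis.constr_apply_fintype, LieRing.of_associative_ring_bracket]
        simp only [Fin.sum_univ_two, Module.Basis.equivFun_apply, Matrix.cons_val_zero,
          Matrix.cons_val_one, ← h, add_mul, mul_add, smul_mul_assoc, mul_smul_comm]
        module }

theorem liftOfBasis_zero {R : Type*} [Ring R] [Algebra k R] (e : Module.Basis (Fin 2) k L) {ε : k}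
    (he : ⁅e 0, e 1⁆ = ε • e 0) (A B : R) (h : A * B - B * A = ε • A) :
    liftOfBasis e he A B h (ι k (e 0)) = A := by
  rw [liftOfBasis, UniversalEnvelopingAlgebra.lift_ι_apply]
  change e.constr k ![A, B] (e 0) = A
  simp

theorem liftOfBasis_one {R : Type*} [Ring R] [Algebra k R] (e : Module.Basis (Fin 2) k L) {ε : k}
    (he : ⁅e 0, e 1⁆ = ε • e 0) (A B : R) (h : A * B - B * A = ε • A) :
    liftOfBasis e he A B h (ι k (e 1)) = B := by
  rw [liftOfBasis, UniversalEnvelopingAlgebra.lift_ι_apply]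
  change e.constr k ![A, B] (e 1) = B
  simp

end EnvelopingGeneral

/-! ### A Poincaré-Birkhoff-Witt basis in dimension two -/

section PBW

open Polynomial

variable {k : Type u} [Field k] {L : Type v} [LieRing L] [LieAlgebra k L]

/-- Multiplication by the inner variable. -/
def pbwB (k : Type u) [Field k] : Module.End k k[X][X] := LinearMap.mulLeft k (C X)

/-- `F(t, s) ↦ s F(t + ε, s)`. -/
def pbwA (ε : k) : Module.End k k[X][X] :=
  LinearMap.mulLeft k X ∘ₗ (mapAlgHom (aeval (X + C ε : k[X]) : k[X] →ₐ[k] k[X])).toLinearMap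

/-- Moving the substitution `t ↦ t + ε` past multiplication by `t` costs exactly `ε`, so polynomials
in `t` and `s` become a module over `U(L)`. -/
theorem pbw_relation (ε : k) : pbwA ε * pbwB k - pbwB k * pbwA ε = ε • pbwA ε := by
  ext1 F
  simp [pbwA, pbwB, Module.End.mul_apply, Algebra.smul_def, Polynomial.algebraMap_apply]
  ring

variable (e : Module.Basis (Fin 2) k L) {ε : k}

theorem ι_zero_mul_ι_one (he : ⁅e 0, e 1⁆ = ε • e 0) :
    ι k (e 0) * ι k (e 1) = (ι k (e 1) + algebraMap k _ ε) * ι k (e 0) := by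
  have h := ι_mul_sub (k := k) (e 0) (e 1)
  rw [he, map_smul, sub_eq_iff_eq_add] at h
  rw [h, add_mul, ← Algebra.smul_def, add_comm]

/-- `a bʲ = (b + ε)ʲ a`. -/
theorem ι_zero_mul_ι_one_pow (he : ⁅e 0, e 1⁆ = ε • e 0) (j : ℕ) :
    ι k (e 0) * ι k (e 1) ^ j = (ι k (e 1) + algebraMap k _ ε) ^ j * ι k (e 0) :=
  SemiconjBy.pow_right (ι_zero_mul_ι_one e he) j

/-- The monomial `bʲ aⁱ`. -/
def pbwMonomial (n : ℕ × ℕ) : UniversalEnvelopingAlgebra k L := ι k (e 1) ^ n.1 * ι k (e 0) ^ n.2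

/-- In the polynomial module, `bʲ aⁱ` sends `1` to the monomial `tʲ sⁱ`: the substitution inside `a`
is invisible on polynomials in `s` alone. Distinct monomials are independent. -/
theorem linearIndependent_pbwMonomial (he : ⁅e 0, e 1⁆ = ε • e 0) :
    LinearIndependent k (pbwMonomial e) := by
  have hA : ∀ i : ℕ, (pbwA ε ^ i) 1 = X ^ i := by
    intro i
    induction i with
    | zero => simp
    | succ i ih => rw [pow_succ', Module.End.mul_apply, ih]; simp [pbwA, pow_succ']
  have hB : ∀ (j : ℕ) (F : k[X][X]), (pbwB k ^ j) F = C (X ^ j) * F := by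
    intro j F
    induction j with
    | zero => simp
    | succ j ih => rw [pow_succ', Module.End.mul_apply, ih]; simp [pbwB, pow_succ']; ring
  let φ := liftOfBasis e he (pbwA ε) (pbwB k) (pbw_relation ε)
  refine LinearIndependent.of_comp ((LinearMap.applyₗ (1 : k[X][X])) ∘ₗ φ.toLinearMap) ?_
  convert ((basisMonomials k).smulTower (basisMonomials k[X])).linearIndependent using 1
  funext n
  rw [Module.Basis.smulTower_apply]
  simp [pbwMonomial, φ, -UniversalEnvelopingAlgebra.ι_apply, liftOfBasis_zero, liftOfBasis_one,
    Module.End.mul_apply, hA, hB, X_pow_eq_monomial, smul_monomial, C_mul_monomial]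

/-- The span contains `1` and is a left ideal: `b` only raises an exponent, and `a` passes `bʲ` by
turning it into `(b + ε)ʲ`, a polynomial in `b`. -/
theorem span_pbwMonomial (he : ⁅e 0, e 1⁆ = ε • e 0) :
    ⊤ ≤ Submodule.span k (Set.range (pbwMonomial e)) := by
  intro t _
  refine mem_of_left_stable (Submodule.span k (Set.range (pbwMonomial e)))
    (Submodule.subset_span ⟨((0, 0) : ℕ × ℕ), by simp [pbwMonomial]⟩) ?_ t
  have hmem : ∀ (f : k[X]) (i : ℕ), aeval (ι k (e 1)) f * ι k (e 0) ^ i ∈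
      Submodule.span k (Set.range (pbwMonomial e)) := by
    intro f i
    rw [aeval_eq_sum_range, Finset.sum_mul]
    refine Submodule.sum_mem _ fun j _ => ?_
    rw [smul_mul_assoc]
    exact Submodule.smul_mem _ _ (Submodule.subset_span ⟨(j, i), rfl⟩)
  intro v s hs
  have hv : ι k v = e.repr v 0 • ι k (e 0) + e.repr v 1 • ι k (e 1) := by
    conv_lhs => rw [← e.sum_repr v]
    rw [Fin.sum_univ_two, map_add, map_smul, map_smul]
  induction hs using Submodule.span_induction with
  | zero => rw [mul_zero]; exact Submodule.zero_mem _
  | add s s' _ _ h h' => rw [mul_add]; exact Submodule.add_mem _ h h'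
  | smul c s _ h => rw [mul_smul_comm]; exact Submodule.smul_mem _ _ h
  | mem s hs =>
    obtain ⟨⟨j, i⟩, rfl⟩ := hs
    rw [hv, add_mul, smul_mul_assoc, smul_mul_assoc]
    refine Submodule.add_mem _ (Submodule.smul_mem _ _ ?_) (Submodule.smul_mem _ _ ?_)
    · have h := hmem ((X + C ε) ^ j) (i + 1)
      rwa [map_pow, map_add, aeval_X, aeval_C, pow_succ', ← mul_assoc,
        ← ι_zero_mul_ι_one_pow e he, mul_assoc] at h
    · refine Submodule.subset_span ⟨(j + 1, i), ?_⟩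
      simp only [pbwMonomial, pow_succ', mul_assoc]

/-- The basis `bʲ aⁱ` of `U(L)`. -/
def pbwBasis (he : ⁅e 0, e 1⁆ = ε • e 0) :
    Module.Basis (ℕ × ℕ) k (UniversalEnvelopingAlgebra k L) :=
  Module.Basis.mk (linearIndependent_pbwMonomial e he) (span_pbwMonomial e he)

theorem pbwBasis_apply (he : ⁅e 0, e 1⁆ = ε • e 0) (n : ℕ × ℕ) :
    pbwBasis e he n = ι k (e 1) ^ n.1 * ι k (e 0) ^ n.2 := by
  rw [pbwBasis, Module.Basis.mk_apply, pbwMonomial]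

/-- `Δ(bʲ aⁱ) = ∑ C(j, s) C(i, t) bˢ aᵗ ⊗ b^(j - s) a^(i - t)`. -/
theorem comul_pbwBasis (he : ⁅e 0, e 1⁆ = ε • e 0) (n : ℕ × ℕ) :
    Coalgebra.comul (R := k) (pbwBasis e he n) =
      ∑ s ∈ Finset.HasAntidiagonal.antidiagonal n.1, ∑ t ∈ Finset.HasAntidiagonal.antidiagonal n.2,
        ((n.1.choose s.1 * n.2.choose t.1 : ℕ) : k) •
          pbwBasis e he (s.1, t.1) ⊗ₜ[k] pbwBasis e he (s.2, t.2) := by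
  have hpow : ∀ (v : L) (j : ℕ), envComul k L (ι k v) ^ j =
      ∑ s ∈ Finset.HasAntidiagonal.antidiagonal j, ((j.choose s.1 : ℕ) : k) • (ι k v ^ s.1) ⊗ₜ[k] (ι k v ^ s.2) := by
    intro v j
    rw [envComul_ι, Commute.add_pow' (by
      simp [Commute, SemiconjBy, -UniversalEnvelopingAlgebra.ι_apply])]
    refine Finset.sum_congr rfl fun s _ => ?_
    simp only [Algebra.TensorProduct.tmul_pow, Algebra.TensorProduct.tmul_mul_tmul, one_pow,
      one_mul, mul_one, Nat.cast_smul_eq_nsmul]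
  change envComul k L _ = _
  rw [pbwBasis_apply, map_mul, map_pow, map_pow, hpow, hpow, Finset.sum_mul_sum]
  refine Finset.sum_congr rfl fun s _ => Finset.sum_congr rfl fun t _ => ?_
  rw [smul_mul_smul_comm, Algebra.TensorProduct.tmul_mul_tmul, pbwBasis_apply, pbwBasis_apply,
    Nat.cast_mul]

/-- The coefficients of `Δu` in terms of those of `u`. -/
theorem coord_tmul_coord_comul (he : ⁅e 0, e 1⁆ = ε • e 0) (m n : ℕ × ℕ)
    (u : UniversalEnvelopingAlgebra k L) :
    LinearMap.mul' k k (TensorProduct.map ((pbwBasis e he).coord m) ((pbwBasis e he).coord n)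
      (Coalgebra.comul (R := k) u)) =
      (((m.1 + n.1).choose m.1 * (m.2 + n.2).choose m.2 : ℕ) : k) *
        (pbwBasis e he).coord (m + n) u := by
  have key : LinearMap.mul' k k ∘ₗ TensorProduct.map ((pbwBasis e he).coord m)
      ((pbwBasis e he).coord n) ∘ₗ Coalgebra.comul (R := k) =
      (((m.1 + n.1).choose m.1 * (m.2 + n.2).choose m.2 : ℕ) : k) •
        (pbwBasis e he).coord (m + n) := by
    refine (pbwBasis e he).ext fun l => ?_
    rw [LinearMap.comp_apply, LinearMap.comp_apply, comul_pbwBasis]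
    simp only [map_sum, map_smul, TensorProduct.map_tmul, LinearMap.mul'_apply,
      Module.Basis.coord_apply, Module.Basis.repr_self, LinearMap.smul_apply]
    rw [Finset.sum_comm' (t' := Finset.HasAntidiagonal.antidiagonal l.2)
      (s' := fun _ => Finset.HasAntidiagonal.antidiagonal l.1) (by simp)]
    -- The coordinates `m` and `n` pick at most one term of the double sum, and only if the
    -- exponents add up to `l`.
    by_cases hl : l = m + n
    · subst hl
      rw [Finset.sum_eq_single (m.2, n.2), Finset.sum_eq_single (m.1, n.1)]
      · simp
      · rintro ⟨s, s'⟩ hs hne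
        rw [Finsupp.single_apply, Finsupp.single_apply]
        simp only [Finset.HasAntidiagonal.mem_antidiagonal, ne_eq, Prod.fst_add, Prod.ext_iff] at hs hne ⊢
        have : s ≠ m.1 := fun h => hne ⟨h, by omega⟩
        simp [this]
      · simp
      · rintro ⟨t, t'⟩ ht hne
        refine Finset.sum_eq_zero fun s hs => ?_
        rw [Finsupp.single_apply, Finsupp.single_apply]
        simp only [Finset.HasAntidiagonal.mem_antidiagonal, ne_eq, Prod.snd_add, Prod.ext_iff] at ht hne ⊢
        have : t ≠ m.2 := fun h => hne ⟨h, by omega⟩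
        simp [this]
      · simp
    · rw [Finsupp.single_apply, if_neg hl, smul_zero]
      refine Finset.sum_eq_zero fun t ht => Finset.sum_eq_zero fun s hs => ?_
      rw [Finsupp.single_apply, Finsupp.single_apply]
      simp only [Finset.HasAntidiagonal.mem_antidiagonal] at ht hs
      by_cases h1 : (s.1, t.1) = m
      · rw [if_neg (c := (s.2, t.2) = n), mul_zero, smul_zero]
        rintro rfl
        subst h1
        exact hl (by ext <;> simp [hs, ht])
      · rw [if_neg h1, zero_mul, smul_zero]
  exact LinearMap.congr_fun key u

end PBW
end
end HopfOre

namespace HopfOre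

noncomputable section

open UniversalEnvelopingAlgebra (ι)

attribute [local instance 100] LieRing.ofAssociativeRing

/-- If `p` divides all inner binomial coefficients in row `j > 0`, then `j` is a power of `p`. -/
theorem exists_eq_prime_pow_of_dvd_choose {p j : ℕ} (hp : p.Prime) (hj : j ≠ 0)
    (h : ∀ s, 0 < s → s < j → p ∣ j.choose s) : ∃ r, j = p ^ r := by
  have := Fact.mk hp
  obtain ⟨r, m, hm, rfl⟩ := Nat.exists_eq_pow_mul_and_not_dvd hj p hp.ne_one
  refine ⟨r, ?_⟩
  by_contra hne
  have hm0 : m ≠ 0 := by rintro rfl; simp at hj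
  have hm1 : m ≠ 1 := by rintro rfl; simp at hne
  have hpos : 0 < p ^ r := pow_pos hp.pos r
  have hd := h (p ^ r) hpos (by nlinarith [show 2 ≤ m by omega])
  -- Lucas' theorem, one base-`p` digit at a time. As `p` does not divide `m`, this inner binomial
  -- coefficient contradicts the hypothesis unless `m = 1`.
  have key : ∀ r, (p ^ r * m).choose (p ^ r) ≡ m [MOD p] := by
    intro r
    induction r with
    | zero => simp; rfl
    | succ r ih =>
      refine (Choose.choose_modEq_choose_mod_mul_choose_div_nat).trans ?_
      rw [pow_succ', mul_assoc, Nat.mul_mod_right, Nat.mul_mod_right,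
        Nat.mul_div_cancel_left _ hp.pos, Nat.mul_div_cancel_left _ hp.pos]
      simpa using ih
  exact hm ((Nat.modEq_zero_iff_dvd).1 ((key r).symm.trans ((Nat.modEq_zero_iff_dvd).2 hd)))

/-! ### Cocommutativity and primitive elements -/

section Cocommutative

variable {k : Type u} [Field k] {L : Type v} [LieRing L] [LieAlgebra k L]

/-- Both sides are algebra homomorphisms that agree on `L`. This is the source of every symmetry
constraint in the classification. -/
theorem comm_comul (u : UniversalEnvelopingAlgebra k L) :
    TensorProduct.comm k _ _ (Coalgebra.comul (R := k) u) = Coalgebra.comul (R := k) u := by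
  have h : (Algebra.TensorProduct.comm k _ _).toAlgHom.comp (envComul k L) = envComul k L := by
    refine env_hom_ext k fun v => ?_
    change Algebra.TensorProduct.comm k _ _ (envComul k L (ι k v)) = _
    rw [envComul_ι, map_add, Algebra.TensorProduct.comm_tmul, Algebra.TensorProduct.comm_tmul,
      add_comm]
  exact congrArg (fun F : _ →ₐ[k] _ => F u) h

theorem comul_ι (v : L) : Coalgebra.comul (R := k) (ι k v) = ι k v ⊗ₜ[k] 1 + 1 ⊗ₜ[k] ι k v :=
  envComul_ι k v

theorem isSkewPrimitive_ι (v : L) : IsSkewPrimitive k 1 1 (ι k v) := comul_ι v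

end Cocommutative

section Primitive

variable {k : Type u} [Field k] {A : Type v} [Ring A] [HopfAlgebra k A]

theorem IsSkewPrimitive.add {g h x y : A} (hx : IsSkewPrimitive k g h x)
    (hy : IsSkewPrimitive k g h y) : IsSkewPrimitive k g h (x + y) := by
  unfold IsSkewPrimitive at *
  rw [map_add, hx, hy, TensorProduct.add_tmul, TensorProduct.tmul_add]
  abel

theorem IsSkewPrimitive.smul {g h x : A} (hx : IsSkewPrimitive k g h x) (c : k) :
    IsSkewPrimitive k g h (c • x) := by
  unfold IsSkewPrimitive at *
  rw [map_smul, hx, smul_add, TensorProduct.smul_tmul', TensorProduct.tmul_smul]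

theorem IsSkewPrimitive.sub {g h x y : A} (hx : IsSkewPrimitive k g h x)
    (hy : IsSkewPrimitive k g h y) : IsSkewPrimitive k g h (x - y) := by
  rw [sub_eq_add_neg, ← neg_one_smul k y]
  exact hx.add (hy.smul _)

theorem isSkewPrimitive_zero (g h : A) : IsSkewPrimitive k g h 0 := by
  simp [IsSkewPrimitive]

/-- `Δ(xy)` for primitive elements `x` and `y`. -/
theorem IsSkewPrimitive.comul_mul {x y : A} (hx : IsSkewPrimitive k 1 1 x)
    (hy : IsSkewPrimitive k 1 1 y) : Coalgebra.comul (R := k) (x * y) =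
      (x * y) ⊗ₜ[k] 1 + 1 ⊗ₜ[k] (x * y) + (x ⊗ₜ[k] y + y ⊗ₜ[k] x) := by
  rw [Bialgebra.comul_mul, hx, hy]
  simp only [add_mul, mul_add, Algebra.TensorProduct.tmul_mul_tmul, one_mul, mul_one]
  abel

end Primitive

/-! ### Group-like and primitive elements of `U(L)` -/

section PrimitiveElements

variable {k : Type u} [Field k] {L : Type v} [LieRing L] [LieAlgebra k L]
  (e : Module.Basis (Fin 2) k L) {ε : k} (he : ⁅e 0, e 1⁆ = ε • e 0)

theorem pbwBasis_zero : pbwBasis e he (0, 0) = 1 := by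
  simp [pbwBasis_apply]

theorem coord_one (n : ℕ × ℕ) : (pbwBasis e he).coord n 1 = if n = 0 then 1 else 0 := by
  rw [← pbwBasis_zero e he, Module.Basis.coord_apply, Module.Basis.repr_self, Finsupp.single_apply]
  simp [eq_comm (a := n)]; rfl

include he in
/-- The only group-like element of `U(L)` is `1`. -/
theorem eq_one_of_groupLike {r : UniversalEnvelopingAlgebra k L} (h0 : r ≠ 0)
    (h : Coalgebra.comul (R := k) r = r ⊗ₜ[k] r) : r = 1 := by
  let B := pbwBasis e he
  have key : ∀ m n : ℕ × ℕ, B.coord m r * B.coord n r =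
      (((m.1 + n.1).choose m.1 * (m.2 + n.2).choose m.2 : ℕ) : k) * B.coord (m + n) r := by
    intro m n
    rw [← coord_tmul_coord_comul, h]
    simp [B]
  have hsupp : (B.repr r).support.Nonempty := by
    rw [Finsupp.support_nonempty_iff]
    simpa using h0
  -- Take a monomial `n` of maximal total degree. If `n ≠ 0`, then `2n` is not in the support, and
  -- the coordinate of `r ⊗ r` at `(n, n)`, the square of a nonzero scalar, would vanish.
  obtain ⟨n, hn, hmax⟩ := (B.repr r).support.exists_max_image (fun n => n.1 + n.2) hsupp
  have hn0 : n = 0 := by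
    by_contra hne
    have h2 := key n n
    have hz : B.coord (n + n) r = 0 := by
      by_contra hnz
      have := hmax (n + n) (Finsupp.mem_support_iff.2 hnz)
      simp only [Prod.fst_add, Prod.snd_add] at this
      exact hne (Prod.ext (by simp; omega) (by simp; omega))
    rw [hz, mul_zero, mul_self_eq_zero] at h2
    exact Finsupp.mem_support_iff.1 hn h2
  subst hn0
  have h1 : B.coord 0 r = 1 := by
    have h2 := key 0 0
    have h3 : B.coord 0 r ≠ 0 := Finsupp.mem_support_iff.1 hn
    simp only [Prod.fst_zero, Prod.snd_zero, add_zero, Nat.choose_self, mul_one, Nat.cast_one,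
      one_mul] at h2
    exact mul_left_cancel₀ h3 (by rw [h2, mul_one])
  refine B.ext_elem fun m => ?_
  change B.coord m r = B.coord m 1
  rw [coord_one]
  split_ifs with hm
  · rw [hm, h1]
  · by_contra hne
    have := hmax m (Finsupp.mem_support_iff.2 hne)
    simp only [Prod.fst_zero, Prod.snd_zero] at this
    exact hm (Prod.ext (by simp; omega) (by simp; omega))

theorem ι_zero_pow (n : ℕ) : ι k (e 0) ^ n = pbwBasis e he (0, n) := by
  simp [pbwBasis_apply, -UniversalEnvelopingAlgebra.ι_apply]

theorem ι_one_pow (n : ℕ) : ι k (e 1) ^ n = pbwBasis e he (n, 0) := by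
  simp [pbwBasis_apply, -UniversalEnvelopingAlgebra.ι_apply]

variable {p : ℕ}

theorem coord_pSum (α α' : ℕ →₀ k) (n : ℕ × ℕ) :
    (pbwBasis e he).coord n (pSum p (e 0) (e 1) α α') =
      (α.sum fun i c => if (0, p ^ i) = n then c else 0) +
        α'.sum fun i c => if (p ^ i, 0) = n then c else 0 := by
  simp only [pSum, ι_zero_pow e he, ι_one_pow e he, map_add, map_finsuppSum, map_smul,
    Module.Basis.coord_apply, Module.Basis.repr_self, Finsupp.single_apply, smul_eq_mul, mul_ite,
    mul_one, mul_zero]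

theorem coord_pSum_zero (hp : p.Prime) (α α' : ℕ →₀ k) (r : ℕ) :
    (pbwBasis e he).coord (0, p ^ r) (pSum p (e 0) (e 1) α α') = α r := by
  have hp0 := hp.ne_zero
  rw [coord_pSum]
  simp [Nat.pow_right_inj hp.two_le, hp0]

theorem coord_pSum_one (hp : p.Prime) (α α' : ℕ →₀ k) (r : ℕ) :
    (pbwBasis e he).coord (p ^ r, 0) (pSum p (e 0) (e 1) α α') = α' r := by
  have hp0 := hp.ne_zero
  rw [coord_pSum]
  simp [Nat.pow_right_inj hp.two_le, hp0]

include he in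
theorem pSum_injective (hp : p.Prime) {α α' β β' : ℕ →₀ k}
    (h : pSum p (e 0) (e 1) α α' = pSum p (e 0) (e 1) β β') : α = β ∧ α' = β' :=
  ⟨Finsupp.ext fun r => by rw [← coord_pSum_zero e he hp α α', h, coord_pSum_zero e he hp],
    Finsupp.ext fun r => by rw [← coord_pSum_one e he hp α α', h, coord_pSum_one e he hp]⟩

theorem pSum_mem_hatL (a b : L) (α α' : ℕ →₀ k) : pSum p a b α α' ∈ hatL p k L :=
  Submodule.add_mem _
    (Submodule.sum_mem _ fun r _ => Submodule.smul_mem _ _ (Submodule.subset_span ⟨a, r, rfl⟩))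
    (Submodule.sum_mem _ fun r _ => Submodule.smul_mem _ _ (Submodule.subset_span ⟨b, r, rfl⟩))

include he in
/-- In characteristic `p`, the primitive elements of `U(L)` are the combinations of the `a ^ (p ^ i)`
and the `b ^ (p ^ i)`. -/
theorem exists_eq_pSum [CharP k p] (hp : p.Prime) {t : UniversalEnvelopingAlgebra k L}
    (h : IsSkewPrimitive k 1 1 t) : ∃ α α' : ℕ →₀ k, t = pSum p (e 0) (e 1) α α' := by
  let B := pbwBasis e he
  -- Compare the coordinates at `(m, n)` of `Δt` and of `t ⊗ 1 + 1 ⊗ t`. For `m` and `n` both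
  -- nonzero the latter is zero, so either the coordinate of `t` at `m + n` vanishes or the binomial
  -- factor does.
  have key : ∀ m n : ℕ × ℕ, B.coord m t * (if n = 0 then 1 else 0) +
      (if m = 0 then 1 else 0) * B.coord n t =
      (((m.1 + n.1).choose m.1 * (m.2 + n.2).choose m.2 : ℕ) : k) * B.coord (m + n) t := by
    intro m n
    rw [← coord_tmul_coord_comul, h, ← coord_one e he, ← coord_one e he]
    simp [B]
  have hpow : ∀ n : ℕ × ℕ, B.coord n t ≠ 0 → (∃ r, n = (0, p ^ r)) ∨ ∃ r, n = (p ^ r, 0) := by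
    rintro ⟨j, i⟩ hn
    rcases Nat.eq_zero_or_pos i with rfl | hi
    · rcases Nat.eq_zero_or_pos j with rfl | hj
      · refine absurd ?_ hn
        simpa using key (0, 0) (0, 0)
      · right
        obtain ⟨r, rfl⟩ := exists_eq_prime_pow_of_dvd_choose hp hj.ne' fun s hs hsj => by
          have := key (s, 0) (j - s, 0)
          rw [if_neg (by simp [Prod.ext_iff]; omega), if_neg (by simp [Prod.ext_iff]; omega)] at this
          simp only [Prod.mk_add_mk, add_zero, Nat.add_sub_cancel' hsj.le, Nat.choose_self, mul_one,
            mul_zero, zero_mul] at this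
          exact (CharP.cast_eq_zero_iff k p _).1 ((mul_eq_zero.1 this.symm).resolve_right hn)
        exact ⟨r, rfl⟩
    · rcases Nat.eq_zero_or_pos j with rfl | hj
      · left
        obtain ⟨r, rfl⟩ := exists_eq_prime_pow_of_dvd_choose hp hi.ne' fun s hs hsj => by
          have := key (0, s) (0, i - s)
          rw [if_neg (by simp [Prod.ext_iff]; omega), if_neg (by simp [Prod.ext_iff]; omega)] at this
          simp only [Prod.mk_add_mk, add_zero, Nat.add_sub_cancel' hsj.le, Nat.choose_self, one_mul,
            mul_zero, zero_mul] at this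
          exact (CharP.cast_eq_zero_iff k p _).1 ((mul_eq_zero.1 this.symm).resolve_right hn)
        exact ⟨r, rfl⟩
      -- A mixed monomial splits as `bʲ` times `aⁱ` with binomial factor `1`, so it cannot occur.
      · have := key (j, 0) (0, i)
        rw [if_neg (by simp [Prod.ext_iff]; omega), if_neg (by simp [Prod.ext_iff]; omega)] at this
        simp only [Prod.mk_add_mk, add_zero, zero_add, Nat.choose_self, Nat.choose_zero_right,
          mul_one, mul_zero, zero_mul, Nat.cast_one, one_mul] at this
        exact absurd this.symm hn
  have hmem : t ∈ Submodule.span k (Set.range fun r => ι k (e 0) ^ p ^ r) ⊔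
      Submodule.span k (Set.range fun r => ι k (e 1) ^ p ^ r) := by
    rw [← B.linearCombination_repr t, Finsupp.linearCombination_apply]
    refine Submodule.sum_mem _ fun n hn => Submodule.smul_mem _ _ ?_
    rcases hpow n (Finsupp.mem_support_iff.1 hn) with ⟨r, rfl⟩ | ⟨r, rfl⟩
    · exact Submodule.mem_sup_left (Submodule.subset_span ⟨r, ι_zero_pow e he _⟩)
    · exact Submodule.mem_sup_right (Submodule.subset_span ⟨r, ι_one_pow e he _⟩)
  obtain ⟨s, hs, s', hs', rfl⟩ := Submodule.mem_sup.1 hmem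
  obtain ⟨α, rfl⟩ := Finsupp.mem_span_range_iff_exists_finsupp.1 hs
  obtain ⟨α', rfl⟩ := Finsupp.mem_span_range_iff_exists_finsupp.1 hs'
  exact ⟨α, α', rfl⟩

include he in
theorem mem_hatL_of_primitive [CharP k p] (hp : p.Prime) {t : UniversalEnvelopingAlgebra k L}
    (h : IsSkewPrimitive k 1 1 t) : t ∈ hatL p k L := by
  obtain ⟨α, α', rfl⟩ := exists_eq_pSum e he hp h
  exact pSum_mem_hatL _ _ _ _

end PrimitiveElements

/-! ### Brackets of primitive elements with `a` and `b` -/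

section Commutators

variable {k : Type u} [Field k] {L : Type v} [LieRing L] [LieAlgebra k L]
  (e : Module.Basis (Fin 2) k L) {p : ℕ} [CharP k p]

/-- `[x, a] = α' a` if `[a, b] = a`. -/
theorem opComm_pSum_zero (hp : p.Prime) (he : ⁅e 0, e 1⁆ = e 0) (α α' : ℕ →₀ k) :
    opComm (pSum p (e 0) (e 1) α α') (ι k (e 0)) = negSum α' • ι k (e 0) := by
  have := Fact.mk hp
  have he' : ⁅e 0, e 1⁆ = (1 : k) • e 0 := by rw [he, one_smul]
  have : Nontrivial (UniversalEnvelopingAlgebra k L) :=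
    ⟨1, 0, by rw [← pbwBasis_zero e he']; exact (pbwBasis e he').ne_zero _⟩
  have : CharP (UniversalEnvelopingAlgebra k L) p :=
    charP_of_injective_algebraMap (algebraMap k _).injective p
  -- In characteristic `p`, `(b + 1) ^ p ^ r = b ^ p ^ r + 1`, so every such power of `b` has the
  -- same bracket with `a`.
  have hb : ∀ r, ι k (e 1) ^ p ^ r * ι k (e 0) - ι k (e 0) * ι k (e 1) ^ p ^ r = - ι k (e 0) := by
    intro r
    rw [ι_zero_mul_ι_one_pow e he', add_pow_char_pow_of_commute _ _ (Algebra.commutes _ _).symm,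
      map_one (algebraMap k _), one_pow, add_mul, one_mul]
    abel
  have ha : ∀ r, ι k (e 0) ^ p ^ r * ι k (e 0) - ι k (e 0) * ι k (e 0) ^ p ^ r = 0 := by
    intro r
    rw [← pow_succ, ← pow_succ', sub_self]
  have h : opComm (pSum p (e 0) (e 1) α α') (ι k (e 0)) =
      (α.sum fun r c => c • (ι k (e 0) ^ p ^ r * ι k (e 0) - ι k (e 0) * ι k (e 0) ^ p ^ r)) +
      α'.sum fun r c => c • (ι k (e 1) ^ p ^ r * ι k (e 0) - ι k (e 0) * ι k (e 1) ^ p ^ r) := by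
    simp only [opComm, pSum, Finsupp.sum, add_mul, mul_add, Finset.sum_mul, Finset.mul_sum,
      smul_sub, smul_mul_assoc, mul_smul_comm, Finset.sum_sub_distrib]
    abel
  rw [h]
  simp only [ha, hb, smul_zero, Finsupp.sum, Finset.sum_const_zero, zero_add, negSum, neg_smul,
    Finset.sum_smul, smul_neg, Finset.sum_neg_distrib]

/-- `[x, b] = α₀ a` if `[a, b] = a`. -/
theorem opComm_pSum_one (he : ⁅e 0, e 1⁆ = e 0) (α α' : ℕ →₀ k) :
    opComm (pSum p (e 0) (e 1) α α') (ι k (e 1)) = α 0 • ι k (e 0) := by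
  have he' : ⁅e 0, e 1⁆ = (1 : k) • e 0 := by rw [he, one_smul]
  have hab : ι k (e 0) * ι k (e 1) = ι k (e 1) * ι k (e 0) + ι k (e 0) := by
    rw [ι_zero_mul_ι_one e he', add_mul, map_one (algebraMap k _), one_mul]
  have hn : ∀ n : ℕ, ι k (e 0) ^ n * ι k (e 1) - ι k (e 1) * ι k (e 0) ^ n =
      (n : k) • ι k (e 0) ^ n := by
    intro n
    induction n with
    | zero => simp
    | succ n ih =>
      rw [sub_eq_iff_eq_add] at ih ⊢
      rw [pow_succ', mul_assoc, ih, mul_add, ← mul_assoc, ← mul_assoc, hab, mul_smul_comm]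
      push_cast
      rw [add_mul]
      module
  have ha : ∀ r, ι k (e 0) ^ p ^ r * ι k (e 1) - ι k (e 1) * ι k (e 0) ^ p ^ r =
      if r = 0 then ι k (e 0) else 0 := by
    intro r
    rw [hn]
    split_ifs with hr
    · subst hr; simp
    · simp [CharP.cast_eq_zero, hr]
  have hb : ∀ r, ι k (e 1) ^ p ^ r * ι k (e 1) - ι k (e 1) * ι k (e 1) ^ p ^ r = 0 := by
    intro r
    rw [← pow_succ, ← pow_succ', sub_self]
  have h : opComm (pSum p (e 0) (e 1) α α') (ι k (e 1)) =
      (α.sum fun r c => c • (ι k (e 0) ^ p ^ r * ι k (e 1) - ι k (e 1) * ι k (e 0) ^ p ^ r)) +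
      α'.sum fun r c => c • (ι k (e 1) ^ p ^ r * ι k (e 1) - ι k (e 1) * ι k (e 1) ^ p ^ r) := by
    simp only [opComm, pSum, Finsupp.sum, add_mul, mul_add, Finset.sum_mul, Finset.mul_sum,
      smul_sub, smul_mul_assoc, mul_smul_comm, Finset.sum_sub_distrib]
    abel
  rw [h]
  simp only [ha, hb, smul_zero, smul_ite]
  simp [-UniversalEnvelopingAlgebra.ι_apply, Finsupp.sum]
  intro h0
  rw [h0, zero_smul]

end Commutators

end
end HopfOre

namespace HopfOre

noncomputable section

/-! ### Ore extensions -/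

section Ore

variable {k : Type u} [Field k] {A : Type v} [Ring A] [Algebra k A] {H : Type w} [Ring H]
  [Algebra k H]

/-- `(aₙ) ↦ ∑ aₙ zⁿ`. -/
def oreMap (i : A →ₐ[k] H) (z : H) : (ℕ →₀ A) →ₗ[k] H :=
  Finsupp.lsum k fun n => LinearMap.mulRight k (z ^ n) ∘ₗ i.toLinearMap

theorem oreMap_apply (i : A →ₐ[k] H) (z : H) (f : ℕ →₀ A) :
    oreMap i z f = f.sum fun n a => i a * z ^ n := rfl

theorem oreMap_single (i : A →ₐ[k] H) (z : H) (n : ℕ) (a : A) :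
    oreMap i z (Finsupp.single n a) = i a * z ^ n := by
  simp [oreMap_apply]

/-- Left multiplication by `z` on `∑ aₙ zⁿ`, if `z a = τ(a) z + δ(a)`. -/
def oreOp (τ δ : A →ₗ[k] A) : (ℕ →₀ A) →ₗ[k] (ℕ →₀ A) :=
  Finsupp.lsum k fun n => Finsupp.lsingle (n + 1) ∘ₗ τ + Finsupp.lsingle n ∘ₗ δ

theorem oreOp_single (τ δ : A →ₗ[k] A) (n : ℕ) (a : A) :
    oreOp τ δ (Finsupp.single n a) =
      Finsupp.single (n + 1) (τ a) + Finsupp.single n (δ a) := by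
  simp [oreOp]

theorem oreOp_apply_zero (τ δ : A →ₗ[k] A) (f : ℕ →₀ A) : oreOp τ δ f 0 = δ (f 0) := by
  induction f using Finsupp.induction_linear with
  | zero => simp
  | add f g hf hg => simp [hf, hg]
  | single n a =>
    rw [oreOp_single]
    rcases n with _ | n <;> simp

theorem oreOp_apply_succ (τ δ : A →ₗ[k] A) (f : ℕ →₀ A) (n : ℕ) :
    oreOp τ δ f (n + 1) = τ (f n) + δ (f (n + 1)) := by
  induction f using Finsupp.induction_linear with
  | zero => simp
  | add f g hf hg => simp only [map_add, Finsupp.add_apply, hf, hg]; abel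
  | single m a =>
    rw [oreOp_single]
    simp only [Finsupp.add_apply, Finsupp.single_apply, add_left_inj]
    split_ifs <;> simp

theorem mul_oreMap {i : A →ₐ[k] H} {z : H} {τ δ : A →ₗ[k] A}
    (h : ∀ a : A, z * i a = i (τ a) * z + i (δ a)) (f : ℕ →₀ A) :
    z * oreMap i z f = oreMap i z (oreOp τ δ f) := by
  induction f using Finsupp.induction_linear with
  | zero => simp
  | add f g hf hg => simp only [map_add, mul_add, hf, hg]
  | single m a =>
    rw [oreOp_single, map_add, oreMap_single, oreMap_single, oreMap_single, ← mul_assoc, h,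
      add_mul, pow_succ', mul_assoc]

/-- Left multiplication by `a` on `∑ aₙ zⁿ`. -/
def oreLeft (a : A) : (ℕ →₀ A) →ₗ[k] (ℕ →₀ A) := Finsupp.mapRange.linearMap (LinearMap.mulLeft k a)

theorem oreLeft_apply (a : A) (f : ℕ →₀ A) (n : ℕ) : oreLeft (k := k) a f n = a * f n := rfl

theorem oreLeft_single (a b : A) (n : ℕ) :
    oreLeft (k := k) a (Finsupp.single n b) = Finsupp.single n (a * b) := by
  simp [oreLeft]

theorem i_mul_oreMap (i : A →ₐ[k] H) (z : H) (a : A) (f : ℕ →₀ A) :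
    i a * oreMap i z f = oreMap i z (oreLeft (k := k) a f) := by
  induction f using Finsupp.induction_linear with
  | zero => simp
  | add f g hf hg => simp only [map_add, mul_add, hf, hg]
  | single m b => rw [oreLeft_single, oreMap_single, oreMap_single, map_mul, mul_assoc]

namespace IsOreExtension

variable {τ : A →ₐ[k] A} {δ : A →ₗ[k] A} {i : A →ₐ[k] H} {z : H} (h : IsOreExtension τ δ i z)

include h

/-- The left coefficients with respect to the powers of `z`. -/
def coeff (n : ℕ) : H →ₗ[k] A :=
  Finsupp.lapply n ∘ₗ (LinearEquiv.ofBijective (oreMap i z) h.basis).symm.toLinearMap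

theorem coeff_oreMap (n : ℕ) (f : ℕ →₀ A) : h.coeff n (oreMap i z f) = f n := by
  have := (LinearEquiv.ofBijective (oreMap i z) h.basis).symm_apply_apply f
  exact congrArg (fun g : ℕ →₀ A => g n) this

theorem coeff_mul_pow (n m : ℕ) (a : A) :
    h.coeff n (i a * z ^ m) = if m = n then a else 0 := by
  rw [← oreMap_single, coeff_oreMap, Finsupp.single_apply]

theorem coeff_mul_z (n : ℕ) (a : A) : h.coeff n (i a * z) = if 1 = n then a else 0 := by
  simpa using h.coeff_mul_pow n 1 a

theorem coeff_i (n : ℕ) (a : A) : h.coeff n (i a) = if 0 = n then a else 0 := by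
  simpa using h.coeff_mul_pow n 0 a

theorem coeff_z (n : ℕ) : h.coeff n z = if 1 = n then 1 else 0 := by
  simpa using h.coeff_mul_pow n 1 1

theorem coeff_i_mul (n : ℕ) (a : A) (t : H) : h.coeff n (i a * t) = a * h.coeff n t := by
  obtain ⟨f, rfl : oreMap i z f = t⟩ := h.basis.2 t
  rw [i_mul_oreMap, coeff_oreMap, coeff_oreMap, oreLeft_apply]

theorem z_mul_oreMap (f : ℕ →₀ A) : z * oreMap i z f = oreMap i z (oreOp τ.toLinearMap δ f) :=
  mul_oreMap (fun a => h.relation a) f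

theorem coeff_zero_z_mul (t : H) : h.coeff 0 (z * t) = δ (h.coeff 0 t) := by
  obtain ⟨f, rfl : oreMap i z f = t⟩ := h.basis.2 t
  rw [z_mul_oreMap h, coeff_oreMap, coeff_oreMap, oreOp_apply_zero]

theorem coeff_succ_z_mul (n : ℕ) (t : H) :
    h.coeff (n + 1) (z * t) = τ (h.coeff n t) + δ (h.coeff (n + 1) t) := by
  obtain ⟨f, rfl : oreMap i z f = t⟩ := h.basis.2 t
  rw [z_mul_oreMap h, coeff_oreMap, coeff_oreMap, coeff_oreMap, oreOp_apply_succ]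
  rfl

/-- An additive subgroup that contains `1` and is stable under left multiplication by the
generators is everything. -/
theorem mem_of_left_stable (S : Submodule k H) (h1 : 1 ∈ S) (hi : ∀ a, ∀ s ∈ S, i a * s ∈ S)
    (hz : ∀ s ∈ S, z * s ∈ S) (t : H) : t ∈ S := by
  obtain ⟨f, rfl⟩ := h.basis.2 t
  refine Submodule.sum_mem _ fun n hn => hi _ _ ?_
  clear hn
  induction n with
  | zero => simpa using h1
  | succ n ih => rw [pow_succ']; exact hz _ ih

/-- Powers of `z + u` are monic of the same degree in `z`, so the change of variable is
unitriangular. -/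
theorem coeff_add_pow (u : A) (m : ℕ) :
    h.coeff m ((z + i u) ^ m) = 1 ∧ ∀ n, m < n → h.coeff n ((z + i u) ^ m) = 0 := by
  induction m with
  | zero =>
    have h1 : (1 : H) = i 1 := (map_one i).symm
    rw [pow_zero, h1]
    exact ⟨by rw [coeff_i, if_pos rfl], fun n hn => by rw [coeff_i, if_neg hn.ne]⟩
  | succ m ih =>
    simp only [pow_succ', add_mul, map_add, coeff_i_mul]
    refine ⟨by simp [coeff_succ_z_mul, ih.1, ih.2], fun n hn => ?_⟩
    obtain ⟨n, rfl⟩ : ∃ l, n = l + 1 := ⟨n - 1, by omega⟩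
    simp [coeff_succ_z_mul, ih.2 n (by omega), ih.2 (n + 1) (by omega)]

/-- Replacing `z` by `z + u` turns `δ` into `s ↦ δ(s) + us - τ(s)u`. -/
theorem shift (u : A) : IsOreExtension τ
    (δ + LinearMap.mulLeft k u - LinearMap.mulRight k u ∘ₗ τ.toLinearMap) i (z + i u) := by
  have hrel : ∀ a : A, (z + i u) * i a = i (τ a) * (z + i u) +
      i ((δ + LinearMap.mulLeft k u - LinearMap.mulRight k u ∘ₗ τ.toLinearMap) a) := by
    intro a
    simp only [LinearMap.sub_apply, LinearMap.add_apply, LinearMap.mulLeft_apply,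
      LinearMap.comp_apply, LinearMap.mulRight_apply, AlgHom.toLinearMap_apply, map_sub, map_add,
      map_mul, add_mul, mul_add, h.relation a]
    abel
  refine ⟨fun a b => ?_, hrel, ?_, ?_⟩
  · simp only [LinearMap.sub_apply, LinearMap.add_apply, LinearMap.mulLeft_apply,
      LinearMap.comp_apply, LinearMap.mulRight_apply, AlgHom.toLinearMap_apply, h.derivation,
      map_mul, mul_add, add_mul, sub_mul, mul_sub, mul_assoc]
    abel
  · change Function.Injective (oreMap i (z + i u))
    rw [injective_iff_map_eq_zero]
    intro f hf
    by_contra hne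
    have hs : f.support.Nonempty := Finsupp.support_nonempty_iff.2 hne
    -- In a vanishing combination of powers of `z + u`, the top exponent alone contributes to the
    -- coefficient of `zⁿ`, and it contributes the leading coefficient itself.
    obtain ⟨n, hn, hle⟩ := f.support.exists_max_image id hs
    simp only [id] at hle
    have h0 := congrArg (h.coeff n) hf
    rw [oreMap_apply, Finsupp.sum, map_sum, Finset.sum_eq_single n] at h0
    · rw [coeff_i_mul, (h.coeff_add_pow u n).1, mul_one, map_zero] at h0
      exact Finsupp.mem_support_iff.1 hn h0
    · intro m hm hmn
      rw [coeff_i_mul, (h.coeff_add_pow u m).2 n (lt_of_le_of_ne (hle m hm) hmn), mul_zero]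
    · exact fun hn' => absurd hn hn'
  · intro t
    refine h.mem_of_left_stable (LinearMap.range (oreMap i (z + i u)))
      ⟨Finsupp.single 0 1, by simp [oreMap_single]⟩ ?_ ?_ t
    · rintro a _ ⟨f, rfl⟩
      exact ⟨_, (i_mul_oreMap i _ a f).symm⟩
    · rintro _ ⟨f, rfl⟩
      have h1 : z * oreMap i (z + i u) f =
          (z + i u) * oreMap i (z + i u) f - i u * oreMap i (z + i u) f := by
        rw [add_mul, add_sub_cancel_right]
      rw [h1, mul_oreMap (τ := τ.toLinearMap) hrel, i_mul_oreMap, ← map_sub]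
      exact ⟨_, rfl⟩

end IsOreExtension

end Ore

/-! ### Consequences of coassociativity -/

section HopfExtension

variable {k : Type u} [Field k] {A : Type v} [Ring A] [HopfAlgebra k A] {H : Type w} [Ring H]
  [HopfAlgebra k H]

/-- Contract the first factor with a functional that does not vanish at `x`. -/
theorem tmul_left_cancel {x : A} (hx : x ≠ 0) {M : Type*} [AddCommGroup M] [Module k M] {s t : M}
    (h : x ⊗ₜ[k] s = x ⊗ₜ[k] t) : s = t := by
  obtain ⟨f, hf⟩ := Module.Projective.exists_dual_ne_zero k hx
  have := congrArg (fun w => TensorProduct.lid k M (f.rTensor M w)) h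
  simp only [LinearMap.rTensor_tmul, TensorProduct.lid_tmul] at this
  exact smul_right_injective M hf this

theorem toLinearMap_hom (i : A →ₐc[k] H) (a : A) : (i : A →ₐ[k] H).toLinearMap a = i a := rfl

theorem comul_hom (i : A →ₐc[k] H) (a : A) : Coalgebra.comul (R := k) (i a) =
    TensorProduct.map (i : A →ₐ[k] H).toLinearMap (i : A →ₐ[k] H).toLinearMap
      (Coalgebra.comul (R := k) a) :=
  (CoalgHomClass.map_comp_comul_apply i a).symm

theorem Ad_one : Ad (k := k) (1 : A) = LinearMap.id := by
  ext a
  simp [Ad, Algebra.TensorProduct.one_def]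

theorem twist_one_apply (χ : A →ₐ[k] k) (a : A) :
    twist χ 1 a = TensorProduct.lid k A (χ.toLinearMap.rTensor A (Coalgebra.comul (R := k) a)) := by
  rw [twist, LinearMap.comp_apply]
  generalize Coalgebra.comul (R := k) a = t
  induction t using TensorProduct.induction_on with
  | zero => simp
  | add t t' h h' => simp only [map_add, h, h']
  | tmul s t => simp [Ad_one]

theorem twist_one_of_primitive (χ : A →ₐ[k] k) {s : A} (hs : IsSkewPrimitive k 1 1 s) :
    twist χ 1 s = s + χ s • 1 := by
  rw [twist_one_apply, hs]
  simp [add_comm]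

namespace IsGeneralizedHopfOre

variable {τ : A →ₐ[k] A} {δ : A →ₗ[k] A} {r₁ r₂ x y : A} {i : A →ₐc[k] H} {z : H}

section Coassociativity

variable (h : IsGeneralizedHopfOre τ δ r₁ r₂ x y i z)

include h

theorem coeff_hom (n : ℕ) (a : A) : h.ore.coeff n (i a) = if 0 = n then a else 0 :=
  h.ore.coeff_i n a

theorem coeff_zero_comp :
    h.ore.coeff 0 ∘ₗ (i : A →ₐ[k] H).toLinearMap = LinearMap.id :=
  LinearMap.ext fun a => by simpa using h.coeff_hom 0 a

theorem coeff_one_comp : h.ore.coeff 1 ∘ₗ (i : A →ₐ[k] H).toLinearMap = 0 :=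
  LinearMap.ext fun a => by simpa using h.coeff_hom 1 a

theorem map_zero_zero_hom (a : A) : TensorProduct.map (h.ore.coeff 0) (h.ore.coeff 0)
    (Coalgebra.comul (R := k) (i a)) = Coalgebra.comul (R := k) a := by
  rw [comul_hom, ← LinearMap.comp_apply, ← TensorProduct.map_comp, h.coeff_zero_comp,
    TensorProduct.map_id, LinearMap.id_apply]

theorem map_one_zero_hom (a : A) : TensorProduct.map (h.ore.coeff 1) (h.ore.coeff 0)
    (Coalgebra.comul (R := k) (i a)) = 0 := by
  rw [comul_hom, ← LinearMap.comp_apply, ← TensorProduct.map_comp, h.coeff_one_comp,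
    TensorProduct.map_zero_left, LinearMap.zero_apply]

theorem map_zero_one_hom (a : A) : TensorProduct.map (h.ore.coeff 0) (h.ore.coeff 1)
    (Coalgebra.comul (R := k) (i a)) = 0 := by
  rw [comul_hom, ← LinearMap.comp_apply, ← TensorProduct.map_comp, h.coeff_one_comp,
    TensorProduct.map_zero_right, LinearMap.zero_apply]

/-- The coefficient pairs `(0, 0)`, `(1, 0)` and `(0, 1)` isolate the three summands of `Δz`,
because elements of `A` have no `z`-part and `z` has no constant part. -/
theorem map_zero_zero_z : TensorProduct.map (h.ore.coeff 0) (h.ore.coeff 0)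
    (Coalgebra.comul (R := k) z) = x ⊗ₜ[k] y := by
  rw [h.comul_z]
  simp [h.coeff_hom, IsOreExtension.coeff_z]

theorem map_one_zero_z : TensorProduct.map (h.ore.coeff 1) (h.ore.coeff 0)
    (Coalgebra.comul (R := k) z) = 1 ⊗ₜ[k] r₁ := by
  rw [h.comul_z]
  simp [h.coeff_hom, IsOreExtension.coeff_z]

theorem map_zero_one_z : TensorProduct.map (h.ore.coeff 0) (h.ore.coeff 1)
    (Coalgebra.comul (R := k) z) = r₂ ⊗ₜ[k] 1 := by
  rw [h.comul_z]
  simp [h.coeff_hom, IsOreExtension.coeff_z]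

/-- Coassociativity at `z`, read through three functionals. Each choice of coefficients for `f`,
`g`, `l` below extracts one identity in `A ⊗ A ⊗ A`. -/
theorem coassoc_coeff (f g l : H →ₗ[k] A) :
    TensorProduct.assoc k A A A
      (TensorProduct.map f g (Coalgebra.comul (R := k) z) ⊗ₜ l (i r₁) +
        TensorProduct.map f g (Coalgebra.comul (R := k) (i x)) ⊗ₜ l (i y) +
        TensorProduct.map f g (Coalgebra.comul (R := k) (i r₂)) ⊗ₜ l z) =
      f z ⊗ₜ TensorProduct.map g l (Coalgebra.comul (R := k) (i r₁)) +
        f (i x) ⊗ₜ TensorProduct.map g l (Coalgebra.comul (R := k) (i y)) +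
        f (i r₂) ⊗ₜ TensorProduct.map g l (Coalgebra.comul (R := k) z) := by
  have key := congrArg (TensorProduct.map f (TensorProduct.map g l))
    (Coalgebra.coassoc_apply (R := k) z)
  have hassoc : ∀ t : (H ⊗[k] H) ⊗[k] H, TensorProduct.map f (TensorProduct.map g l)
      (TensorProduct.assoc k H H H t) =
      TensorProduct.assoc k A A A (TensorProduct.map (TensorProduct.map f g) l t) := fun t =>
    LinearMap.congr_fun (TensorProduct.map_map_comp_assoc_eq f g l) t
  rw [hassoc] at key
  rw [h.comul_z] at key
  simpa only [map_add, LinearMap.rTensor_tmul, LinearMap.lTensor_tmul, TensorProduct.map_tmul]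
    using key

variable [Nontrivial A]

/-- The terms of coassociativity with `z` in the first tensor factor; for `r₂` it is the last
factor. -/
theorem comul_r₁ : Coalgebra.comul (R := k) r₁ = r₁ ⊗ₜ[k] r₁ := by
  have key := h.coassoc_coeff (h.ore.coeff 1) (h.ore.coeff 0) (h.ore.coeff 0)
  simp only [h.map_one_zero_z, h.map_one_zero_hom, h.map_zero_zero_hom, h.coeff_hom,
    IsOreExtension.coeff_z] at key
  simp only [↓reduceIte, zero_ne_one, one_ne_zero, TensorProduct.tmul_zero, TensorProduct.zero_tmul,
    add_zero, TensorProduct.assoc_tmul] at key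
  exact (tmul_left_cancel one_ne_zero key).symm

theorem comul_r₂ : Coalgebra.comul (R := k) r₂ = r₂ ⊗ₜ[k] r₂ := by
  have key := h.coassoc_coeff (h.ore.coeff 0) (h.ore.coeff 0) (h.ore.coeff 1)
  simp only [h.map_zero_one_z, h.map_zero_one_hom, h.map_zero_zero_hom, h.coeff_hom,
    IsOreExtension.coeff_z] at key
  simp only [↓reduceIte, zero_ne_one, one_ne_zero, TensorProduct.tmul_zero, zero_add] at key
  rw [← TensorProduct.assoc_tmul, EmbeddingLike.apply_eq_iff_eq] at key
  have := congrArg (TensorProduct.comm k _ _) key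
  rw [TensorProduct.comm_tmul, TensorProduct.comm_tmul] at this
  exact tmul_left_cancel one_ne_zero this

-- The part of coassociativity that is constant in all three factors. It is the only condition that
-- coassociativity at `z` puts on `x` and `y` together.
omit [Nontrivial A] in
theorem tmul_relation : TensorProduct.assoc k A A A
      ((x ⊗ₜ[k] y) ⊗ₜ[k] r₁ + Coalgebra.comul (R := k) x ⊗ₜ[k] y) =
    x ⊗ₜ[k] Coalgebra.comul (R := k) y + r₂ ⊗ₜ[k] (x ⊗ₜ[k] y) := by
  have key := h.coassoc_coeff (h.ore.coeff 0) (h.ore.coeff 0) (h.ore.coeff 0)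
  simp only [h.map_zero_zero_z, h.map_zero_zero_hom, h.coeff_hom, IsOreExtension.coeff_z] at key
  simpa using key

/-- By the counit axiom `z` equals the contraction of `Δz`, whose `z`-coefficient is the counit of
`r₁`. -/
theorem r₁_ne_zero : r₁ ≠ 0 := by
  intro h0
  have key := congrArg (h.ore.coeff 1) (congrArg (TensorProduct.rid k H)
    (Coalgebra.lTensor_counit_comul (R := k) z))
  rw [h.comul_z] at key
  simp [IsOreExtension.coeff_z, h.coeff_hom, h0] at key

theorem r₂_ne_zero : r₂ ≠ 0 := by
  intro h0
  have key := congrArg (h.ore.coeff 1) (congrArg (TensorProduct.lid k H)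
    (Coalgebra.rTensor_counit_comul (R := k) z))
  rw [h.comul_z] at key
  simp [IsOreExtension.coeff_z, h.coeff_hom, h0] at key

end Coassociativity

/-- If `A` has no group-like elements other than `1`, then either `x` and `y` are primitive, or
`x ⊗ y` is a scalar. -/
theorem primitive_or_scalar [Nontrivial A] (h : IsGeneralizedHopfOre τ δ 1 1 x y i z)
    (hG : ∀ r : A, r ≠ 0 → Coalgebra.comul (R := k) r = r ⊗ₜ[k] r → r = 1) :
    (IsSkewPrimitive k 1 1 x ∧ IsSkewPrimitive k 1 1 y) ∨
      ∃ c : k, x ⊗ₜ[k] y = c • (1 : A) ⊗ₜ[k] (1 : A) := by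
  by_cases hx : x = 0
  · exact Or.inr ⟨0, by simp [hx]⟩
  by_cases hy : y = 0
  · exact Or.inr ⟨0, by simp [hy]⟩
  have key := h.tmul_relation
  obtain ⟨f, hf⟩ := Module.Projective.exists_dual_ne_zero k hy
  -- Contracting the third factor of the relation with `f`, where `f y ≠ 0`, solves for `Δx`; `v`
  -- collects everything that ends up next to `x`.
  obtain ⟨v, hv⟩ : ∃ v : A, Coalgebra.comul (R := k) x = x ⊗ₜ[k] v + 1 ⊗ₜ[k] x := by
    have h1 := congrArg (TensorProduct.map LinearMap.id
      ((TensorProduct.rid k A).toLinearMap ∘ₗ f.lTensor A)) key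
    have h2 : ∀ (t : A ⊗[k] A) (b : A), TensorProduct.map LinearMap.id
      ((TensorProduct.rid k A).toLinearMap ∘ₗ f.lTensor A)
        (TensorProduct.assoc k A A A (t ⊗ₜ[k] b)) = f b • t := by
      intro t b
      induction t using TensorProduct.induction_on with
      | zero => simp
      | add t t' h h' => simp only [TensorProduct.add_tmul, map_add, h, h', smul_add]
      | tmul s t => simp [TensorProduct.tmul_smul]
    rw [map_add, map_add, map_add, h2, h2] at h1
    simp only [TensorProduct.map_tmul, LinearMap.id_apply, LinearMap.comp_apply,
      LinearMap.lTensor_tmul, LinearEquiv.coe_coe, TensorProduct.rid_tmul] at h1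
    refine ⟨(f y)⁻¹ • (TensorProduct.rid k A (f.lTensor A (Coalgebra.comul (R := k) y)) -
      f 1 • y), ?_⟩
    rw [TensorProduct.tmul_smul, TensorProduct.tmul_sub, TensorProduct.tmul_smul]
    rw [TensorProduct.tmul_smul] at h1
    have h3 : f y • Coalgebra.comul (R := k) x =
      x ⊗ₜ[k] (TensorProduct.rid k A (f.lTensor A (Coalgebra.comul (R := k) y))) -
        f 1 • x ⊗ₜ[k] y + f y • (1 : A) ⊗ₜ[k] x := by
      rw [sub_add_eq_add_sub, ← h1]; abel
    rw [← inv_smul_smul₀ hf (Coalgebra.comul (R := k) x), h3, smul_add, inv_smul_smul₀ hf]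
  -- Insert the formula for `Δx` into the relation and cancel `x` on the left.
  have hy' : Coalgebra.comul (R := k) y = y ⊗ₜ[k] 1 + v ⊗ₜ[k] y := by
    rw [hv, TensorProduct.add_tmul, map_add, map_add, ← add_assoc, TensorProduct.assoc_tmul,
      TensorProduct.assoc_tmul, TensorProduct.assoc_tmul, add_left_inj, ← TensorProduct.tmul_add]
      at key
    exact (tmul_left_cancel hx key).symm
  have hv' : Coalgebra.comul (R := k) v = v ⊗ₜ[k] v := by
    have h1 := Coalgebra.coassoc_apply (R := k) x
    rw [hv] at h1
    simp only [map_add, LinearMap.rTensor_tmul, LinearMap.lTensor_tmul, hv,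
      TensorProduct.add_tmul, TensorProduct.tmul_add, TensorProduct.assoc_tmul,
      Bialgebra.comul_one, Algebra.TensorProduct.one_def] at h1
    rw [add_assoc, add_left_inj] at h1
    exact (tmul_left_cancel hx h1).symm
  -- Coassociativity at `x` has made `v` zero or group-like. If `v = 0`, then `Δx = 1 ⊗ x` and `Δy =
  -- y ⊗ 1`, and the counit axiom makes `x` and `y` scalars.
  by_cases h0 : v = 0
  · right
    subst h0
    have hx1 := congrArg (TensorProduct.rid k A) (Coalgebra.lTensor_counit_comul (R := k) x)
    have hy1 := congrArg (TensorProduct.lid k A) (Coalgebra.rTensor_counit_comul (R := k) y)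
    rw [hv] at hx1
    rw [hy'] at hy1
    simp at hx1 hy1
    refine ⟨Coalgebra.counit (R := k) x * Coalgebra.counit (R := k) y, ?_⟩
    conv_lhs => rw [← hx1, ← hy1]
    rw [TensorProduct.smul_tmul_smul]
  · left
    have := hG v h0 hv'
    subst this
    exact ⟨hv, hy'⟩

/-! ### Comultiplying the relation `z a = τ(a) z + δ(a)` -/

section Relation

variable (h : IsGeneralizedHopfOre τ δ 1 1 x y i z)

include h

theorem comul_relation (a : A) :
    (z ⊗ₜ[k] 1 + i x ⊗ₜ[k] i y + 1 ⊗ₜ[k] z) * Coalgebra.comul (R := k) (i a) =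
      Coalgebra.comul (R := k) (i (τ a)) * (z ⊗ₜ[k] 1 + i x ⊗ₜ[k] i y + 1 ⊗ₜ[k] z) +
        Coalgebra.comul (R := k) (i (δ a)) := by
  have key := congrArg (Coalgebra.comul (R := k)) (h.ore.relation a)
  rw [map_add, Bialgebra.comul_mul, Bialgebra.comul_mul, h.comul_z, map_one i] at key
  exact key

/-- `(τ ⊗ id) Δ = Δ τ`. -/
theorem comul_τ (a : A) : Coalgebra.comul (R := k) (τ a) =
    τ.toLinearMap.rTensor A (Coalgebra.comul (R := k) a) := by
  have key := congrArg (TensorProduct.map (h.ore.coeff 1) (h.ore.coeff 0)) (h.comul_relation a)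
  have h1 : ∀ t : A ⊗[k] A, TensorProduct.map (h.ore.coeff 1) (h.ore.coeff 0)
      ((z ⊗ₜ[k] 1 + i x ⊗ₜ[k] i y + 1 ⊗ₜ[k] z) * TensorProduct.map (i : A →ₐ[k] H).toLinearMap
        (i : A →ₐ[k] H).toLinearMap t) = τ.toLinearMap.rTensor A t := by
    intro t
    induction t using TensorProduct.induction_on with
    | zero => simp
    | add t t' h h' => simp only [mul_add, map_add, h, h']
    | tmul s t =>
      have hs : z * i s = i (τ s) * z + i (δ s) := h.ore.relation s
      simp only [TensorProduct.map_tmul, toLinearMap_hom, add_mul,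
        Algebra.TensorProduct.tmul_mul_tmul, one_mul, hs, map_add, ← map_mul, h.coeff_hom,
        LinearMap.rTensor_tmul]
      have h2 : h.ore.coeff 1 (i (τ s) * z) = τ s := by simpa using h.ore.coeff_mul_z 1 (τ s)
      simp [h2]
  have h2 : ∀ t : A ⊗[k] A, TensorProduct.map (h.ore.coeff 1) (h.ore.coeff 0)
      (TensorProduct.map (i : A →ₐ[k] H).toLinearMap (i : A →ₐ[k] H).toLinearMap t *
        (z ⊗ₜ[k] 1 + i x ⊗ₜ[k] i y + 1 ⊗ₜ[k] z)) = t := by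
    intro t
    induction t using TensorProduct.induction_on with
    | zero => simp
    | add t t' h h' => simp only [add_mul, map_add, h, h']
    | tmul s t =>
      have h2 : h.ore.coeff 1 (i s * z) = s := by simpa using h.ore.coeff_mul_z 1 s
      simp only [TensorProduct.map_tmul, toLinearMap_hom, mul_add,
        Algebra.TensorProduct.tmul_mul_tmul, mul_one, map_add, ← map_mul, h.coeff_hom, h2]
      simp
  rw [map_add, h.map_one_zero_hom, comul_hom, comul_hom, h1, h2, add_zero] at key
  exact key.symm

/-- The constant part of `Δ(z a) = Δ(τ(a) z + δ(a))`. -/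
theorem comul_δ (a : A) :
    δ.rTensor A (Coalgebra.comul (R := k) a) + x ⊗ₜ[k] y * Coalgebra.comul (R := k) a +
      δ.lTensor A (Coalgebra.comul (R := k) a) =
    Coalgebra.comul (R := k) (τ a) * x ⊗ₜ[k] y + Coalgebra.comul (R := k) (δ a) := by
  have key := congrArg (TensorProduct.map (h.ore.coeff 0) (h.ore.coeff 0)) (h.comul_relation a)
  have h1 : ∀ t : A ⊗[k] A, TensorProduct.map (h.ore.coeff 0) (h.ore.coeff 0)
      ((z ⊗ₜ[k] 1 + i x ⊗ₜ[k] i y + 1 ⊗ₜ[k] z) * TensorProduct.map (i : A →ₐ[k] H).toLinearMap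
        (i : A →ₐ[k] H).toLinearMap t) = δ.rTensor A t + x ⊗ₜ[k] y * t + δ.lTensor A t := by
    intro t
    induction t using TensorProduct.induction_on with
    | zero => simp
    | add t t' h h' => simp only [mul_add, map_add, h, h']; abel
    | tmul s t =>
      simp only [TensorProduct.map_tmul, toLinearMap_hom, add_mul,
        Algebra.TensorProduct.tmul_mul_tmul, one_mul, h.ore.coeff_zero_z_mul, map_add, ← map_mul,
        h.coeff_hom, LinearMap.rTensor_tmul, LinearMap.lTensor_tmul]
      simp
  have h2 : ∀ t : A ⊗[k] A, TensorProduct.map (h.ore.coeff 0) (h.ore.coeff 0)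
      (TensorProduct.map (i : A →ₐ[k] H).toLinearMap (i : A →ₐ[k] H).toLinearMap t *
        (z ⊗ₜ[k] 1 + i x ⊗ₜ[k] i y + 1 ⊗ₜ[k] z)) = t * x ⊗ₜ[k] y := by
    intro t
    induction t using TensorProduct.induction_on with
    | zero => simp
    | add t t' h h' => simp only [add_mul, map_add, h, h']
    | tmul s t =>
      have h2 : ∀ s, h.ore.coeff 0 (i s * z) = 0 := fun s => by simpa using h.ore.coeff_mul_z 0 s
      simp only [TensorProduct.map_tmul, toLinearMap_hom, mul_add,
        Algebra.TensorProduct.tmul_mul_tmul, mul_one, map_add, ← map_mul, h.coeff_hom, h2]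
      simp
  rw [map_add, h.map_zero_zero_hom, comul_hom, comul_hom, h1, h2] at key
  exact key

/-- Apply the counit to the first factor of `Δ τ = (τ ⊗ id) Δ`. So, once `r₁ = r₂ = 1`, the twisted
form of `τ` required of a normal extension is automatic. -/
theorem τ_eq_twist :
    τ.toLinearMap = twist ((Bialgebra.counitAlgHom k A).comp τ) 1 := by
  ext a
  have key := congrArg (TensorProduct.lid k A) (Coalgebra.rTensor_counit_comul (R := k) (τ a))
  rw [TensorProduct.lid_tmul, one_smul] at key
  rw [twist_one_apply, AlgHom.toLinearMap_apply, ← key, h.comul_τ, ← LinearMap.comp_apply,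
    ← LinearMap.comp_apply, ← LinearMap.rTensor_comp]
  rfl

/-- `τ(s) = s + χ(s)` for primitive `s`. -/
theorem τ_of_primitive {s : A} (hs : IsSkewPrimitive k 1 1 s) :
    τ s = s + Coalgebra.counit (R := k) (τ s) • 1 := by
  have := LinearMap.congr_fun h.τ_eq_twist s
  rwa [twist_one_of_primitive _ hs] at this

/-- The bracketed term is the defect of `δ s` from being primitive. It arises by commuting `x ⊗ y`
past `Δs` and subtracting the scalar by which `τ` moves `s`. -/
theorem comul_δ_of_primitive {s : A} (hs : IsSkewPrimitive k 1 1 s) :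
    Coalgebra.comul (R := k) (δ s) = δ s ⊗ₜ[k] 1 + 1 ⊗ₜ[k] δ s +
      (opComm x s ⊗ₜ[k] y + x ⊗ₜ[k] opComm y s -
        Coalgebra.counit (R := k) (τ s) • x ⊗ₜ[k] y) := by
  have hδ1 : δ 1 = 0 := by
    have := h.ore.derivation 1 1
    simpa using this
  have key := h.comul_δ s
  rw [h.τ_of_primitive hs, map_add, map_smul, hs] at key
  simp only [map_add, LinearMap.rTensor_tmul, LinearMap.lTensor_tmul, hδ1, mul_add, add_mul,
    TensorProduct.tmul_zero, TensorProduct.zero_tmul, add_zero, zero_add, Bialgebra.comul_one,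
    smul_mul_assoc, one_mul, Algebra.TensorProduct.tmul_mul_tmul, mul_one] at key
  rw [← sub_eq_iff_eq_add'] at key
  rw [← key]
  simp only [opComm, TensorProduct.sub_tmul, TensorProduct.tmul_sub]
  abel

/-- `δ([s, t])` for primitive `s`, `t`. -/
theorem δ_opComm {s t : A} (hs : IsSkewPrimitive k 1 1 s) (ht : IsSkewPrimitive k 1 1 t) :
    δ (opComm s t) = opComm (δ s) t + opComm s (δ t) + Coalgebra.counit (R := k) (τ s) • δ t -
      Coalgebra.counit (R := k) (τ t) • δ s := by
  rw [opComm, map_sub, h.ore.derivation, h.ore.derivation]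
  nth_rewrite 1 [h.τ_of_primitive hs]
  nth_rewrite 1 [h.τ_of_primitive ht]
  simp only [add_mul, smul_mul_assoc, one_mul, opComm]
  abel

/-- Replacing `z` by `z + u`. -/
theorem shift {x' y' : A} (u : A) (hu : Coalgebra.comul (R := k) u + x ⊗ₜ[k] y =
      u ⊗ₜ[k] 1 + 1 ⊗ₜ[k] u + x' ⊗ₜ[k] y') :
    IsGeneralizedHopfOre τ
      (δ + LinearMap.mulLeft k u - LinearMap.mulRight k u ∘ₗ τ.toLinearMap) 1 1 x' y' i
      (z + i u) := by
  refine ⟨h.ore.shift u, ?_⟩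
  have key := congrArg (TensorProduct.map (i : A →ₐ[k] H).toLinearMap
    (i : A →ₐ[k] H).toLinearMap) hu
  rw [map_add, ← comul_hom] at key
  simp only [map_add, TensorProduct.map_tmul, toLinearMap_hom,
    map_one] at key
  rw [map_add, h.comul_z, map_one i, TensorProduct.add_tmul, TensorProduct.tmul_add,
    ← sub_eq_zero]
  rw [← sub_eq_zero] at key
  rw [← key]
  abel

end Relation

end IsGeneralizedHopfOre

end HopfExtension

end
end HopfOre

namespace HopfOre

noncomputable section

open UniversalEnvelopingAlgebra (ι)

attribute [local instance 100] LieRing.ofAssociativeRing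

/-! ### The classification -/

/-- Contracting with a functional that does not vanish at `x` turns symmetry of `x ⊗ y` into
proportionality. -/
theorem exists_smul_eq_of_tmul_comm {k : Type u} [Field k] {V : Type v} [AddCommGroup V]
    [Module k V] {x y : V} (hx : x ≠ 0) (h : x ⊗ₜ[k] y = y ⊗ₜ[k] x) : ∃ c : k, y = c • x := by
  obtain ⟨f, hf⟩ := Module.Projective.exists_dual_ne_zero k hx
  have h1 := congrArg (fun w => TensorProduct.lid k V (f.rTensor V w)) h
  simp only [LinearMap.rTensor_tmul, TensorProduct.lid_tmul] at h1
  refine ⟨(f x)⁻¹ * f y, ?_⟩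
  rw [mul_smul, ← h1, inv_smul_smul₀ hf]

section

variable {k : Type u} [Field k] {L : Type v} [LieRing L] [LieAlgebra k L]

theorem opComm_ι (v w : L) : opComm (ι k v) (ι k w) = ι k ⁅v, w⁆ := ι_mul_sub v w

theorem opComm_ι_eq_zero (hL : ∀ v w : L, ⁅v, w⁆ = 0) (t : UniversalEnvelopingAlgebra k L)
    (v : L) : opComm t (ι k v) = 0 := by
  have := mem_of_ι_mem k (Subalgebra.centralizer k {ι k v}) (fun w => by
    rw [Subalgebra.mem_centralizer_iff]
    rintro _ rfl
    rw [← sub_eq_zero, ι_mul_sub, hL, map_zero]) t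
  rw [Subalgebra.mem_centralizer_iff] at this
  rw [opComm, ← this _ rfl, sub_self]

variable {H : Type w} [Ring H] [HopfAlgebra k H]
  {τ : UniversalEnvelopingAlgebra k L →ₐ[k] UniversalEnvelopingAlgebra k L}
  {δ : UniversalEnvelopingAlgebra k L →ₗ[k] UniversalEnvelopingAlgebra k L}
  {x y : UniversalEnvelopingAlgebra k L} {i : UniversalEnvelopingAlgebra k L →ₐc[k] H} {z : H}

namespace IsGeneralizedHopfOre

/-- The character `χ = ε τ` with `τ(s) = s + χ(s)` on primitive elements. -/
abbrev character (_ : IsGeneralizedHopfOre τ δ 1 1 x y i z) :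
    UniversalEnvelopingAlgebra k L →ₐ[k] k :=
  (Bialgebra.counitAlgHom k _).comp τ

variable (h : IsGeneralizedHopfOre τ δ 1 1 x y i z)

include h

theorem isNormalHopfOre (hx : IsSkewPrimitive k 1 1 x) (hy : IsSkewPrimitive k 1 1 y)
    (hxy : x = 0 ↔ y = 0) : IsNormalHopfOre h.character 1 1 x y δ i z :=
  ⟨⟨τ, h.τ_eq_twist, h⟩, IsGroupLikeElem.one, IsGroupLikeElem.one, hx, hy, hxy⟩

theorem character_lie (v w : L) : h.character (ι k ⁅v, w⁆) = 0 := by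
  rw [← opComm_ι, opComm, map_sub, map_mul, map_mul, mul_comm, sub_self]

theorem comul_δ_ι (v : L) : Coalgebra.comul (R := k) (δ (ι k v)) =
    δ (ι k v) ⊗ₜ[k] 1 + 1 ⊗ₜ[k] δ (ι k v) +
      (opComm x (ι k v) ⊗ₜ[k] y + x ⊗ₜ[k] opComm y (ι k v) -
        h.character (ι k v) • x ⊗ₜ[k] y) :=
  h.comul_δ_of_primitive (isSkewPrimitive_ι v)

theorem δ_lie (v w : L) : δ (ι k ⁅v, w⁆) = opComm (δ (ι k v)) (ι k w) +
    opComm (ι k v) (δ (ι k w)) + h.character (ι k v) • δ (ι k w) -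
      h.character (ι k w) • δ (ι k v) := by
  rw [← opComm_ι]
  exact h.δ_opComm (isSkewPrimitive_ι v) (isSkewPrimitive_ι w)

/-- Cocommutativity of `U(L)` makes the non-primitive part of `Δ(δ(v))` symmetric. -/
theorem symmetric (v : L) :
    opComm x (ι k v) ⊗ₜ[k] y + x ⊗ₜ[k] opComm y (ι k v) - h.character (ι k v) • x ⊗ₜ[k] y =
      y ⊗ₜ[k] opComm x (ι k v) + opComm y (ι k v) ⊗ₜ[k] x -
        h.character (ι k v) • y ⊗ₜ[k] x := by
  have key := comm_comul (k := k) (δ (ι k v))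
  rw [h.comul_δ_ι] at key
  simp only [map_add, map_sub, map_smul, TensorProduct.comm_tmul] at key
  rw [add_comm (1 ⊗ₜ[k] _), add_right_inj] at key
  exact key.symm

end IsGeneralizedHopfOre

variable (e : Module.Basis (Fin 2) k L) {p : ℕ}

theorem IsNormalBasis.exists_smul {e : Module.Basis (Fin 2) k L} (he : IsNormalBasis e) :
    ∃ ε : k, ⁅e 0, e 1⁆ = ε • e 0 := by
  rcases he with h | h
  · exact ⟨0, by rw [h, zero_smul]⟩
  · exact ⟨1, by rw [h, one_smul]⟩

variable [CharP k p]

namespace IsGeneralizedHopfOre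

/-- With `x = y = 0` the defect vanishes, so `δ` maps `L` into the primitive elements. -/
theorem familyA (hp : p.Prime) (he : IsNormalBasis e)
    (h : IsGeneralizedHopfOre τ δ 1 1 0 0 i z) : FamilyA p e h.character 0 0 δ := by
  obtain ⟨ε, he'⟩ := he.exists_smul
  refine ⟨he, rfl, rfl, fun v => mem_hatL_of_primitive e he' hp ?_, h.δ_lie _ _⟩
  have := h.comul_δ_ι v
  simpa [IsSkewPrimitive, -UniversalEnvelopingAlgebra.ι_apply] using this

/-- Here `L` is central, so symmetry of the defect reads `χ(v) (x ⊗ y - y ⊗ x) = 0`. Independence of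
`x` and `y` forces `χ(v) = 0`, and then the defect itself is zero. -/
theorem familyB (hp : p.Prime) (he : ⁅e 0, e 1⁆ = 0)
    (h : IsGeneralizedHopfOre τ δ 1 1 x y i z) (hx : IsSkewPrimitive k 1 1 x)
    (hy : IsSkewPrimitive k 1 1 y) (hx0 : x ≠ 0) (hy0 : y ≠ 0)
    (hxy : Submodule.span k {x} ≠ Submodule.span k {y}) (hind : ∀ c : k, y ≠ c • x) :
    FamilyB p e h.character x y δ := by
  have he' : ⁅e 0, e 1⁆ = (0 : k) • e 0 := by rw [he, zero_smul]
  have hL : ∀ v w : L, ⁅v, w⁆ = 0 := fun v w => by rw [lie_eq_smul_lie e, he, smul_zero]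
  have hχ : ∀ v : L, h.character (ι k v) = 0 := by
    intro v
    by_contra hne
    have hs := h.symmetric v
    simp only [opComm_ι_eq_zero hL, TensorProduct.zero_tmul, TensorProduct.tmul_zero, zero_add,
      zero_sub, neg_inj] at hs
    obtain ⟨c, hc⟩ := exists_smul_eq_of_tmul_comm hx0 (smul_right_injective _ hne hs)
    exact hind c hc
  refine ⟨he, hχ, mem_hatL_of_primitive e he' hp hx, mem_hatL_of_primitive e he' hp hy, hx0, hy0,
    hxy, fun v => mem_hatL_of_primitive e he' hp ?_⟩
  have := h.comul_δ_ι v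
  rw [hχ, opComm_ι_eq_zero hL, opComm_ι_eq_zero hL] at this
  simpa [IsSkewPrimitive, -UniversalEnvelopingAlgebra.ι_apply] using this

end IsGeneralizedHopfOre

/-- The `a`-coordinate for the basis `bʲ aⁱ`. -/
def aCoord (he : ⁅e 0, e 1⁆ = e 0) : UniversalEnvelopingAlgebra k L →ₗ[k] k :=
  (pbwBasis e (ε := (1 : k)) (by rw [he, one_smul])).coord (0, 1)

theorem aCoord_a (he : ⁅e 0, e 1⁆ = e 0) : aCoord e he (ι k (e 0)) = 1 := by
  rw [aCoord, ← pow_one (ι k (e 0)), ι_zero_pow e (ε := (1 : k)) (by rw [he, one_smul]),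
    Module.Basis.coord_apply, Module.Basis.repr_self, Finsupp.single_eq_same]

omit [CharP k p] in
theorem aCoord_pSum (hp : p.Prime) (he : ⁅e 0, e 1⁆ = e 0) (α α' : ℕ →₀ k) :
    aCoord e he (pSum p (e 0) (e 1) α α') = α 0 := by
  have := coord_pSum_zero e (ε := (1 : k)) (by rw [he, one_smul]) hp α α' 0
  rwa [pow_zero] at this

namespace IsGeneralizedHopfOre

/-- Case (ii) of the last family, with `y = a` and `x` free of `a`. -/
theorem familyD (hp : p.Prime) (hp2 : (2 : k) ≠ 0) (he : ⁅e 0, e 1⁆ = e 0)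
    (h : IsGeneralizedHopfOre τ δ 1 1 x (ι k (e 0)) i z) (hx : IsSkewPrimitive k 1 1 x)
    (hx0 : x ≠ 0) (hxa : aCoord e he x = 0) (hχ : h.character (ι k (e 1)) = 1) :
    FamilyD p e h.character x (ι k (e 0)) δ := by
  have he' : ⁅e 0, e 1⁆ = (1 : k) • e 0 := by rw [he, one_smul]
  have hχ0 : h.character (ι k (e 0)) = 0 := by
    have := h.character_lie (e 0) (e 1)
    rwa [he] at this
  have ha0 : ι k (e 0) ≠ 0 := fun h0 => by simpa [h0] using aCoord_a e he
  obtain ⟨α, α', rfl⟩ := exists_eq_pSum e he' hp hx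
  rw [aCoord_pSum e hp] at hxa
  have hxb := opComm_pSum_one (p := p) e he α α'
  have hxa' := opComm_pSum_zero e hp he α α'
  set x := pSum p (e 0) (e 1) α α' with hxdef
  refine ⟨he, hχ0, hχ, hx0, ha0, ?_, ?_, α, α', Finsupp.single 0 1, 0, hxdef, ?_,
    Or.inr (Or.inl ⟨?_, ?_, ?_⟩)⟩
  -- A multiple of `a` with zero `a`-coordinate is zero.
  · intro hspan
    have : x ∈ Submodule.span k {ι k (e 0)} := hspan ▸ Submodule.mem_span_singleton_self x
    obtain ⟨c, hc⟩ := Submodule.mem_span_singleton.1 this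
    have hc' := congrArg (aCoord e he) hc
    rw [map_smul, aCoord_a, hxdef, aCoord_pSum e hp, hxa, smul_eq_mul, mul_one] at hc'
    rw [hc', zero_smul] at hc
    exact hx0 hc.symm
  · have := h.δ_lie (e 0) (e 1)
    rw [he, hχ, hχ0, zero_smul, add_zero, one_smul, eq_sub_iff_add_eq] at this
    rw [two_smul, this]
  · simp [pSum, -UniversalEnvelopingAlgebra.ι_apply]
  · simp
  -- With `y = a` the defect of `δ a` is `α' a ⊗ a`, and that is the non-primitive part of the
  -- comultiplication of `½ α' a²`.
  · refine mem_hatL_of_primitive e he' hp ?_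
    unfold IsSkewPrimitive
    have hsq := (isSkewPrimitive_ι (k := k) (e 0)).comul_mul (isSkewPrimitive_ι (k := k) (e 0))
    rw [map_sub, map_smul, h.comul_δ_ι, hχ0, hxa', opComm_ι, lie_self,
      map_zero (ι k), sq, hsq,
      Finsupp.single_eq_same, mul_one, TensorProduct.sub_tmul, TensorProduct.tmul_sub,
      TensorProduct.tmul_zero, zero_smul, ← two_smul k ((ι k (e 0)) ⊗ₜ[k] (ι k (e 0))),
      smul_add, smul_smul, mul_comm _ (2 : k), mul_inv_cancel_left₀ hp2]
    simp only [← TensorProduct.smul_tmul', TensorProduct.tmul_smul]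
    module
  -- Now `[x, b] = 0`, and `x ⊗ [a, b]` cancels against `χ(b) x ⊗ a`, because `χ(b) = 1`.
  · refine mem_hatL_of_primitive e he' hp ?_
    unfold IsSkewPrimitive
    rw [hxa, mul_zero, zero_mul, zero_smul, sub_zero, h.comul_δ_ι, hχ, hxb, hxa, zero_smul,
      opComm_ι, he, TensorProduct.zero_tmul, one_smul, zero_add, sub_self, add_zero]

/-- Symmetry of the defects at `a` and at `b` decides the case. The ring `H` and the embedding stay
fixed; only `z` is corrected, by an element quadratic in primitives. -/
theorem classification_of_primitive (hp : p.Prime) (hp2 : (2 : k) ≠ 0) (he : IsNormalBasis e)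
    (h : IsGeneralizedHopfOre τ δ 1 1 x y i z) (hx : IsSkewPrimitive k 1 1 x)
    (hy : IsSkewPrimitive k 1 1 y) (hx0 : x ≠ 0) (hy0 : y ≠ 0) :
    ∃ (χ : UniversalEnvelopingAlgebra k L →ₐ[k] k) (x' y' : UniversalEnvelopingAlgebra k L)
      (δ' : UniversalEnvelopingAlgebra k L →ₗ[k] UniversalEnvelopingAlgebra k L) (z' : H),
      IsNormalHopfOre χ 1 1 x' y' δ' i z' ∧ InList p e χ x' y' δ' := by
  by_cases hind : ∃ c : k, y = c • x
  · obtain ⟨c, rfl⟩ := hind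
    -- The cross term of `Δ(x²)` is `2 x ⊗ x`, so half of `c x²` removes `x ⊗ c x`; this needs `2 ≠
    -- 0`.
    have hs := h.shift (x' := 0) (y' := 0) (-(2⁻¹ * c) • (x * x)) (by
      rw [map_smul, hx.comul_mul hx, ← two_smul k (x ⊗ₜ[k] x), smul_add, smul_smul _ (2 : k),
        neg_mul, mul_comm _ (2 : k), mul_inv_cancel_left₀ hp2]
      simp only [← TensorProduct.smul_tmul', TensorProduct.tmul_smul, TensorProduct.tmul_zero]
      module)
    exact ⟨_, _, _, _, _, hs.isNormalHopfOre (isSkewPrimitive_zero _ _) (isSkewPrimitive_zero _ _)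
      Iff.rfl, Or.inl (hs.familyA e hp he)⟩
  push Not at hind
  have hspan : Submodule.span k {x} ≠ Submodule.span k {y} := by
    intro hspan
    have : y ∈ Submodule.span k {x} := hspan ▸ Submodule.mem_span_singleton_self y
    obtain ⟨c, hc⟩ := Submodule.mem_span_singleton.1 this
    exact hind c hc.symm
  have hxy : x = 0 ↔ y = 0 := by simp [hx0, hy0]
  rcases he with he | he
  · exact ⟨_, _, _, _, _, h.isNormalHopfOre hx hy hxy,
      Or.inr (Or.inl (h.familyB e hp he hx hy hx0 hy0 hspan hind))⟩
  have hindep : ∀ s t : k, s • x = t • y → s = 0 ∧ t = 0 := by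
    intro s t hst
    have ht : t = 0 := by
      by_contra ht
      exact hind (t⁻¹ * s) (by rw [mul_smul, hst, inv_smul_smul₀ ht])
    subst ht
    rw [zero_smul] at hst
    exact ⟨(smul_eq_zero.1 hst).resolve_right hx0, rfl⟩
  have he' : ⁅e 0, e 1⁆ = (1 : k) • e 0 := by rw [he, one_smul]
  obtain ⟨α, α', hxe⟩ := exists_eq_pSum e he' hp hx
  obtain ⟨β, β', hye⟩ := exists_eq_pSum e he' hp hy
  have hχ0 : h.character (ι k (e 0)) = 0 := by
    have := h.character_lie (e 0) (e 1)
    rwa [he] at this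
  have hfx : aCoord e he x = α 0 := by rw [hxe, aCoord_pSum e hp]
  have hfy : aCoord e he y = β 0 := by rw [hye, aCoord_pSum e hp]
  have hfa := aCoord_a (k := k) e he
  have hxa : opComm x (ι k (e 0)) = negSum α' • ι k (e 0) := by
    rw [hxe]; exact opComm_pSum_zero e hp he α α'
  have hya : opComm y (ι k (e 0)) = negSum β' • ι k (e 0) := by
    rw [hye]; exact opComm_pSum_zero e hp he β β'
  have hxb : opComm x (ι k (e 1)) = α 0 • ι k (e 0) := by
    rw [hxe]; exact opComm_pSum_one e he α α'
  have hyb : opComm y (ι k (e 1)) = β 0 • ι k (e 0) := by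
    rw [hye]; exact opComm_pSum_one e he β β'
  have hsa := h.symmetric (e 0)
  have hsb := h.symmetric (e 1)
  rw [hxa, hya, hχ0, zero_smul, zero_smul, sub_zero, sub_zero] at hsa
  rw [hxb, hyb] at hsb
  set a := ι k (e 0) with ha
  set c := h.character (ι k (e 1)) with hc
  -- Reading off the `a`-coordinate in the first factor turns the two symmetric tensor identities
  -- into linear relations among `x`, `y` and `a`.
  have hFa := congrArg (fun w => TensorProduct.lid k _ ((aCoord e he).rTensor _ w)) hsa
  have hFb := congrArg (fun w => TensorProduct.lid k _ ((aCoord e he).rTensor _ w)) hsb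
  simp only [map_add, map_sub, map_smul, LinearMap.rTensor_tmul, TensorProduct.lid_tmul, hfx, hfy,
    hfa, smul_eq_mul, mul_one] at hFa hFb
  have hFb' : (1 - c) • (α 0 • y - β 0 • x) = 0 := by
    rw [← sub_eq_zero] at hFb
    rw [← hFb]
    module
  have hzero : β 0 • x = α 0 • y → β 0 = 0 ∧ α 0 = 0 := hindep _ _
  by_cases hc0 : c = 0
  -- For `χ(b) = 0` the relation at `b` gives `α₀ = β₀ = 0`; the one at `a` then reads `α' y = β'
  -- x`, so `α' = β' = 0` and both defects vanish.
  · rw [hc0, sub_zero, one_smul, sub_eq_zero] at hFb'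
    obtain ⟨hβ, hα⟩ := hzero hFb'.symm
    have hFa' : negSum β' • x = negSum α' • y := by
      rw [hα, hβ, zero_smul, zero_smul, add_zero, zero_add] at hFa
      exact hFa.symm
    obtain ⟨hβ', hα'⟩ := hindep _ _ hFa'
    have hδa : IsSkewPrimitive k 1 1 (δ a) := by
      unfold IsSkewPrimitive
      have := h.comul_δ_ι (e 0)
      rw [← ha, hxa, hya, hχ0, hα', hβ'] at this
      simpa only [zero_smul, TensorProduct.zero_tmul, TensorProduct.tmul_zero, add_zero,
        sub_zero] using this
    have hδb : IsSkewPrimitive k 1 1 (δ (ι k (e 1))) := by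
      unfold IsSkewPrimitive
      have := h.comul_δ_ι (e 1)
      rw [hxb, hyb, ← hc, hc0, hα, hβ] at this
      simpa only [zero_smul, TensorProduct.zero_tmul, TensorProduct.tmul_zero, add_zero,
        sub_zero] using this
    have hv : ∀ v : L, ι k v = e.repr v 0 • a + e.repr v 1 • ι k (e 1) := by
      intro v
      conv_lhs => rw [← e.sum_repr v]
      rw [Fin.sum_univ_two, map_add, map_smul, map_smul]
    refine ⟨_, _, _, _, _, h.isNormalHopfOre hx hy hxy, Or.inr (Or.inr (Or.inl
      ⟨he, fun v => ?_, hx0, hy0, hspan, ⟨α, α', β, β', hxe, hye, hα, hβ, hα', hβ'⟩,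
        fun v => mem_hatL_of_primitive e he' hp ?_, ?_⟩))⟩
    · rw [hv, map_add, map_smul, map_smul, hχ0, ← hc, hc0, smul_zero, smul_zero, add_zero]
    · rw [hv, map_add, map_smul, map_smul]
      exact (hδa.smul _).add (hδb.smul _)
    · have := h.δ_lie (e 0) (e 1)
      rwa [he, ← hc, hc0, hχ0, zero_smul, zero_smul, add_zero, sub_zero] at this
  -- If `χ(b)` is neither `0` nor `1`, then again `α₀ = β₀ = 0`, and symmetry at `b` reduces to `x ⊗
  -- y = y ⊗ x`, against independence.
  have hc1 : c = 1 := by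
    by_contra hc1
    have h1c : 1 - c ≠ 0 := sub_ne_zero.2 (Ne.symm hc1)
    have := (smul_eq_zero.1 hFb').resolve_left h1c
    obtain ⟨hβ, hα⟩ := hzero (sub_eq_zero.1 this).symm
    rw [hα, hβ] at hsb
    simp only [zero_smul, TensorProduct.zero_tmul, TensorProduct.tmul_zero, add_zero, zero_sub,
      neg_inj] at hsb
    obtain ⟨d, hd⟩ := exists_smul_eq_of_tmul_comm hx0 (smul_right_injective _ hc0 hsb)
    exact hind d hd
  -- For `χ(b) = 1` the defect at `b` is `α₀β₀ a ⊗ a` minus this tensor, so the latter is symmetric.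
  have hXY : (x - α 0 • a) ⊗ₜ[k] (y - β 0 • a) = (y - β 0 • a) ⊗ₜ[k] (x - α 0 • a) := by
    rw [hc1, one_smul, one_smul] at hsb
    rw [← sub_eq_zero] at hsb ⊢
    rw [← neg_eq_zero, ← hsb]
    simp only [TensorProduct.sub_tmul, TensorProduct.tmul_sub, ← TensorProduct.smul_tmul',
      TensorProduct.tmul_smul]
    module
  have hap : IsSkewPrimitive k 1 1 a := isSkewPrimitive_ι (e 0)
  have hX : IsSkewPrimitive k 1 1 (x - α 0 • a) := hx.sub (hap.smul _)
  have hY : IsSkewPrimitive k 1 1 (y - β 0 • a) := hy.sub (hap.smul _)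
  have hx' : IsSkewPrimitive k 1 1 (β 0 • x - α 0 • y) := (hx.smul _).sub (hy.smul _)
  have hx'0 : β 0 • x - α 0 • y ≠ 0 := by
    intro h0
    obtain ⟨hβ, hα⟩ := hzero (sub_eq_zero.1 h0)
    rw [hα, hβ, zero_smul, sub_zero, sub_zero] at hXY
    obtain ⟨d, hd⟩ := exists_smul_eq_of_tmul_comm hx0 hXY
    exact hind d hd
  -- Put `X = x - α₀ a`, `Y = y - β₀ a` and expand `x ⊗ y = X ⊗ Y + β₀ x ⊗ a + α₀ a ⊗ y - α₀β₀ a ⊗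
  -- a`. The products `½ X Y` and `½ α₀β₀ a²` account for the symmetric tensors, and `α₀ a y` trades
  -- `a ⊗ y` for `-y ⊗ a`. What remains is `(β₀ x - α₀ y) ⊗ a`, whose left factor has `a`-coordinate
  -- zero.
  have hs := h.shift (x' := β 0 • x - α 0 • y) (y' := a)
    (-((2⁻¹ : k) • ((x - α 0 • a) * (y - β 0 • a)) + α 0 • (a * y) -
      (2⁻¹ * (α 0 * β 0)) • (a * a))) (by
    simp only [map_neg, map_sub, map_add, map_smul]
    rw [hX.comul_mul hY, hap.comul_mul hy, hap.comul_mul hap, ← hXY,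
      ← two_smul k ((x - α 0 • a) ⊗ₜ[k] (y - β 0 • a)), ← two_smul k (a ⊗ₜ[k] a), smul_add,
      smul_add _ _ ((2 : k) • a ⊗ₜ[k] a), smul_smul, smul_smul _ (2 : k), inv_mul_cancel₀ hp2,
      mul_comm (2⁻¹ * _) (2 : k), mul_inv_cancel_left₀ hp2]
    simp only [TensorProduct.sub_tmul, TensorProduct.tmul_sub, TensorProduct.add_tmul,
      TensorProduct.tmul_add, TensorProduct.neg_tmul, TensorProduct.tmul_neg,
      ← TensorProduct.smul_tmul', TensorProduct.tmul_smul]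
    module)
  refine ⟨_, _, _, _, _, hs.isNormalHopfOre hx' hap ?_, Or.inr (Or.inr (Or.inr
    (hs.familyD e hp hp2 he hx' hx'0 ?_ hc1)))⟩
  · have ha0 : a ≠ 0 := fun h0 => by simp [h0] at hfa
    simp [hx'0, ha0]
  · rw [map_sub, map_smul, map_smul, hfx, hfy, smul_eq_mul, smul_eq_mul, mul_comm, sub_self]

end IsGeneralizedHopfOre

end

end
end HopfOre

namespace HopfOre

noncomputable section

open UniversalEnvelopingAlgebra (ι)

attribute [local instance 100] LieRing.ofAssociativeRing

/-! ### Two-dimensional Lie algebras -/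

theorem exists_isNormalBasis {k : Type u} [Field k] {L : Type v} [LieRing L] [LieAlgebra k L]
    (hL : Module.finrank k L = 2) : ∃ e : Module.Basis (Fin 2) k L, IsNormalBasis e := by
  have hfin : Module.Finite k L := Module.finite_of_finrank_pos (by omega)
  let e := Module.finBasisOfFinrankEq k L hL
  by_cases h0 : ⁅e 0, e 1⁆ = 0
  · exact ⟨e, Or.inl h0⟩
  set t := ⁅e 0, e 1⁆ with ht
  have ht' : t = e.repr t 0 • e 0 + e.repr t 1 • e 1 := by
    conv_lhs => rw [← e.sum_repr t]
    rw [Fin.sum_univ_two]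
  -- Every bracket is a multiple of `t`, and `[t, s] = (t₀ s₁ - t₁ s₀) t`; choose `s` so that the
  -- scalar is `1`.
  obtain ⟨s, hs⟩ : ∃ s : L, ⁅t, s⁆ = t := by
    by_cases h1 : e.repr t 0 = 0
    · have h2 : e.repr t 1 ≠ 0 := by
        intro h2
        rw [h1, h2, zero_smul, zero_smul, add_zero] at ht'
        exact h0 ht'
      refine ⟨-(e.repr t 1)⁻¹ • e 0, ?_⟩
      rw [lie_eq_smul_lie e, ← ht, map_smul, e.repr_self, h1]
      simp [h2]
    · refine ⟨(e.repr t 0)⁻¹ • e 1, ?_⟩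
      rw [lie_eq_smul_lie e, ← ht, map_smul, e.repr_self]
      simp [h1]
  have hli : LinearIndependent k ![t, s] := by
    rw [LinearIndependent.pair_iff]
    intro c d hcd
    have h1 : ⁅t, c • t + d • s⁆ = 0 := by rw [hcd, lie_zero]
    rw [lie_add, lie_smul, lie_smul, lie_self, hs, smul_zero, zero_add] at h1
    have hd := (smul_eq_zero.1 h1).resolve_right h0
    rw [hd, zero_smul, add_zero] at hcd
    exact ⟨(smul_eq_zero.1 hcd).resolve_right h0, hd⟩
  refine ⟨basisOfLinearIndependentOfCardEqFinrank hli (by simp [hL]), Or.inr ?_⟩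
  simp [hs]

/-! ### Enveloping algebras as Ore extensions -/

section

variable {k : Type u} [Field k] {L : Type v} [LieRing L] [LieAlgebra k L]

/-- By the twisted Leibniz rule, the elements that satisfy the relation form a subalgebra, so
checking it on `L` is enough. -/
theorem relation_of_ι {R : Type*} [Ring R] [Algebra k R] {f : UniversalEnvelopingAlgebra k L →ₐ[k] R}
    {t : R} {τ : UniversalEnvelopingAlgebra k L →ₐ[k] UniversalEnvelopingAlgebra k L}
    {δ : UniversalEnvelopingAlgebra k L →ₗ[k] UniversalEnvelopingAlgebra k L}
    (hδ : ∀ a b, δ (a * b) = τ a * δ b + δ a * b)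
    (h : ∀ v : L, t * f (ι k v) = f (τ (ι k v)) * t + f (δ (ι k v)))
    (a : UniversalEnvelopingAlgebra k L) : t * f a = f (τ a) * t + f (δ a) := by
  have hδ1 : δ 1 = 0 := by simpa using hδ 1 1
  let S : Subalgebra k (UniversalEnvelopingAlgebra k L) :=
    { carrier := {a | t * f a = f (τ a) * t + f (δ a)}
      mul_mem' := fun {a b} ha hb => by
        simp only [Set.mem_ofPred_eq] at ha hb ⊢
        rw [map_mul, ← mul_assoc, ha, add_mul, mul_assoc, hb, hδ]
        simp only [map_mul, map_add, mul_add, mul_assoc, add_assoc]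
      add_mem' := fun {a b} ha hb => by
        simp only [Set.mem_ofPred_eq] at ha hb ⊢
        simp only [map_add, mul_add, add_mul, ha, hb]
        abel
      algebraMap_mem' := fun c => by
        simp only [Set.mem_ofPred_eq]
        simp only [Algebra.algebraMap_eq_smul_one, map_smul, map_one, hδ1, smul_zero, map_zero,
          add_zero, mul_smul_comm, smul_mul_assoc, mul_one, one_mul] }
  exact mem_of_ι_mem k S h a

/-- The relation moves `t` to the right past coefficients, so the polynomials in `t` with left
coefficients contain `1` and are stable under left multiplication by `M`. -/
theorem oreMap_surjective {M : Type w} [LieRing M] [LieAlgebra k M]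
    {f : UniversalEnvelopingAlgebra k L →ₐ[k] UniversalEnvelopingAlgebra k M}
    {t : UniversalEnvelopingAlgebra k M}
    {τ δ : UniversalEnvelopingAlgebra k L →ₗ[k] UniversalEnvelopingAlgebra k L}
    (h : ∀ a, t * f a = f (τ a) * t + f (δ a))
    (hM : ∀ m : M, ∃ (a : UniversalEnvelopingAlgebra k L) (c : k), ι k m = f a + c • t) :
    Function.Surjective (oreMap f t) := by
  intro s
  refine mem_of_left_stable (LinearMap.range (oreMap f t))
    ⟨Finsupp.single 0 1, by simp [oreMap_single]⟩ ?_ s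
  rintro m _ ⟨g, rfl⟩
  obtain ⟨a, c, hm⟩ := hM m
  rw [hm, add_mul, smul_mul_assoc, i_mul_oreMap, mul_oreMap h, ← map_smul, ← map_add]
  exact ⟨_, rfl⟩

end

/-! ### Lie algebras of primitive elements in a Hopf algebra -/

section PrimitiveSubalgebra

variable {k : Type u} [Field k] {H : Type w} [Ring H] [HopfAlgebra k H]

theorem IsSkewPrimitive.counit_eq_zero {t : H} (h : IsSkewPrimitive k 1 1 t) :
    Coalgebra.counit (R := k) t = 0 := by
  have key := congrArg (Coalgebra.counit (R := k)) (congrArg (TensorProduct.lid k H)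
    (Coalgebra.rTensor_counit_comul (R := k) t))
  rw [h] at key
  simpa using key

/-- The homomorphism from the enveloping algebra of a Lie algebra of primitive elements. -/
def envLift (K : LieSubalgebra k H) (hK : ∀ t ∈ K, IsSkewPrimitive k 1 1 t) :
    UniversalEnvelopingAlgebra k K →ₐc[k] H :=
  BialgHom.ofAlgHom (UniversalEnvelopingAlgebra.lift k K.incl)
    (by
      refine env_hom_ext k fun t => ?_
      change Coalgebra.counit (R := k) (UniversalEnvelopingAlgebra.lift k _ (ι k t)) =
        envCounit k K (ι k t)
      rw [UniversalEnvelopingAlgebra.lift_ι_apply, envCounit_ι]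
      exact (hK t t.2).counit_eq_zero)
    (by
      refine env_hom_ext k fun t => ?_
      change Algebra.TensorProduct.map _ _ (envComul k K (ι k t)) =
        Coalgebra.comul (R := k) (UniversalEnvelopingAlgebra.lift k _ (ι k t))
      rw [envComul_ι, UniversalEnvelopingAlgebra.lift_ι_apply]
      simp only [map_add, Algebra.TensorProduct.map_tmul, map_one]
      rw [UniversalEnvelopingAlgebra.lift_ι_apply]
      exact (hK t t.2).symm)

theorem envLift_ι (K : LieSubalgebra k H) (hK : ∀ t ∈ K, IsSkewPrimitive k 1 1 t) (t : K) :
    envLift K hK (ι k t) = t :=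
  UniversalEnvelopingAlgebra.lift_ι_apply k _ t

end PrimitiveSubalgebra

section OreIsEnveloping

variable {k : Type u} [Field k] {L : Type v} [LieRing L] [LieAlgebra k L]
  {H : Type w} [Ring H] [HopfAlgebra k H]

theorem ι_injective (hL : Module.finrank k L = 2) : Function.Injective (ι k : L → _) := by
  obtain ⟨e, he⟩ := exists_isNormalBasis hL
  obtain ⟨ε, he⟩ := he.exists_smul
  have h : LinearIndependent k (fun j => ι k (e j)) := by
    have := (pbwBasis e he).linearIndependent.comp ![(0, 1), (1, 0)] (by decide)
    convert this using 1
    funext j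
    fin_cases j <;> simp [pbwBasis_apply, -UniversalEnvelopingAlgebra.ι_apply]
  rw [injective_iff_map_eq_zero]
  intro v hv
  refine (e.forall_coord_eq_zero_iff (R := k)).1 fun j => ?_
  refine Fintype.linearIndependent_iff.1 h (fun j => e.coord j v) ?_ j
  simp only [← map_smul, ← map_sum]
  rw [← hv]
  exact congrArg _ (e.sum_repr v)

/-- The Lie algebra is `K = L + k z` inside `H`. The products `a zⁿ` span `U(K)`, and the map to `H`
carries them to the Ore basis expansions, which are unique. Bijectivity follows without a basis
theorem for `K`. -/
theorem exists_enveloping (hL : Module.finrank k L = 2)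
    {χ : UniversalEnvelopingAlgebra k L →ₐ[k] k}
    {δ : UniversalEnvelopingAlgebra k L →ₗ[k] UniversalEnvelopingAlgebra k L}
    {i : UniversalEnvelopingAlgebra k L →ₐc[k] H} {z : H}
    (h : IsNormalHopfOre χ 1 1 0 0 δ i z)
    (hδ : ∀ v : L, δ (ι k v) ∈ Set.range (ι k (L := L))) :
    ∃ (M : Type w) (_ : LieRing M) (_ : LieAlgebra k M),
      Module.finrank k M = 3 ∧ (∃ N : LieSubalgebra k M, Module.finrank k N = 2) ∧
        Nonempty (UniversalEnvelopingAlgebra k M ≃ₐc[k] H) := by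
  have hfin : Module.Finite k L := Module.finite_of_finrank_pos (by omega)
  obtain ⟨τ, hτ, hH⟩ := h.extension
  have hτv : ∀ v : L, τ (ι k v) = ι k v + χ (ι k v) • 1 := fun v => by
    rw [← twist_one_of_primitive χ (isSkewPrimitive_ι v), ← hτ]
    rfl
  choose d hd using hδ
  have hz : ∀ v : L, z * i (ι k v) - i (ι k v) * z = χ (ι k v) • z + i (ι k (d v)) := by
    intro v
    have := hH.ore.relation (ι k v)
    rw [hτv, ← hd, map_add, map_smul, map_one, add_mul, smul_mul_assoc, one_mul] at this
    rw [sub_eq_iff_eq_add']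
    exact this.trans (by rw [add_assoc]; rfl)
  have hzp : IsSkewPrimitive k 1 1 z := by
    have := hH.comul_z
    simpa [IsSkewPrimitive] using this
  let φ : L × k →ₗ[k] H := ((i : UniversalEnvelopingAlgebra k L →ₐ[k] H).toLinearMap ∘ₗ (ι k (L := L)).toLinearMap).coprod
    (LinearMap.toSpanSingleton k H z)
  have hφ : ∀ v c, φ (v, c) = i (ι k v) + c • z := fun v c => rfl
  have hφinj : Function.Injective φ := by
    rw [injective_iff_map_eq_zero]
    rintro ⟨v, c⟩ hvc
    rw [hφ] at hvc
    have h0 := congrArg (hH.ore.coeff 0) hvc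
    have h1 := congrArg (hH.ore.coeff 1) hvc
    simp only [map_add, map_smul, hH.coeff_hom, IsOreExtension.coeff_z, map_zero] at h0 h1
    have hv : ι k v = 0 := by simpa using h0
    have hv0 : v = 0 := ι_injective hL (hv.trans (map_zero (ι k)).symm)
    have hc : c = 0 := by
      have : algebraMap k (UniversalEnvelopingAlgebra k L) c = 0 := by
        rw [Algebra.algebraMap_eq_smul_one]; simpa using h1
      simpa using congrArg (Bialgebra.counitAlgHom k (UniversalEnvelopingAlgebra k L)) this
    rw [hv0, hc]
    rfl
  have hφi : ∀ v w : L, ⁅i (ι k v), i (ι k w)⁆ = i (ι k ⁅v, w⁆) := fun v w => by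
    rw [LieRing.of_associative_ring_bracket, ← map_mul i, ← map_mul i, ← map_sub i, ι_mul_sub]
  have hφz : ∀ w : L, ⁅z, i (ι k w)⁆ = χ (ι k w) • z + i (ι k (d w)) := hz
  have hz' : ∀ v : L, z * i (ι k v) = i (ι k v) * z + (χ (ι k v) • z + i (ι k (d v))) :=
    fun v => sub_eq_iff_eq_add'.1 (hz v)
  let K : LieSubalgebra k H :=
    { LinearMap.range φ with
      lie_mem' := by
        rintro _ _ ⟨⟨v, c⟩, rfl⟩ ⟨⟨w, c'⟩, rfl⟩
        -- Expand `[v + c z, w + c' z]` with `[z, w] = χ(w) z + d(w)`.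
        refine ⟨(⁅v, w⁆ + c • d w - c' • d v, c * χ (ι k w) - c' * χ (ι k v)), ?_⟩
        rw [LieRing.of_associative_ring_bracket]
        simp only [hφ, add_mul, mul_add, smul_mul_assoc, mul_smul_comm, hz', map_add, map_sub,
          map_smul, ← ι_mul_sub, map_mul]
        module }
  have hK : ∀ t ∈ K, IsSkewPrimitive k 1 1 t := by
    rintro _ ⟨⟨v, c⟩, rfl⟩
    refine IsSkewPrimitive.add ?_ (hzp.smul c)
    unfold IsSkewPrimitive
    change Coalgebra.comul (R := k) (i (ι k v)) = i (ι k v) ⊗ₜ[k] 1 + 1 ⊗ₜ[k] i (ι k v)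
    rw [comul_hom, comul_ι]
    simp [-UniversalEnvelopingAlgebra.ι_apply]
  have hLK : ∀ v : L, i (ι k v) ∈ K := fun v => ⟨(v, 0), by simp [hφ]⟩
  have hzK : z ∈ K := ⟨(0, 1), by simp [hφ]⟩
  let j : L →ₗ⁅k⁆ K :=
    { toFun := fun v => ⟨i (ι k v), hLK v⟩
      map_add' := fun v w => Subtype.ext (by simp only [map_add]; rfl)
      map_smul' := fun c v => Subtype.ext (by simp only [map_smul]; rfl)
      map_lie' := fun {v w} => Subtype.ext (hφi v w).symm }
  have hj : Function.Injective j := fun v w hvw => by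
    have := hφinj (a₁ := (v, 0)) (a₂ := (w, 0)) (by
      rw [hφ, hφ]; exact congrArg (fun t => t + (0 : k) • z) (congrArg Subtype.val hvw))
    exact (Prod.ext_iff.1 this).1
  let f : UniversalEnvelopingAlgebra k L →ₐ[k] UniversalEnvelopingAlgebra k K :=
    UniversalEnvelopingAlgebra.lift k ((ι k).comp j)
  have hf : ∀ v, f (ι k v) = ι k (j v) := fun v => UniversalEnvelopingAlgebra.lift_ι_apply k _ v
  let t : UniversalEnvelopingAlgebra k K := ι k ⟨z, hzK⟩
  have hrel := relation_of_ι (f := f) (t := t) hH.ore.derivation (fun v => by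
    have h1 : ⁅(⟨z, hzK⟩ : K), j v⁆ = χ (ι k v) • ⟨z, hzK⟩ + j (d v) := Subtype.ext (hφz v)
    have h2 := ι_mul_sub (k := k) (⟨z, hzK⟩ : K) (j v)
    rw [h1, map_add, map_smul, sub_eq_iff_eq_add'] at h2
    rw [hτv, ← hd, map_add, map_smul, map_one, hf, hf, add_mul, smul_mul_assoc, one_mul,
      add_assoc, h2])
  have hsurj : Function.Surjective (oreMap f t) := oreMap_surjective (τ := τ.toLinearMap) hrel (by
    rintro ⟨_, ⟨⟨v, c⟩, rfl⟩⟩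
    refine ⟨ι k v, c, ?_⟩
    rw [hf, ← map_smul, ← map_add]
    rfl)
  -- The map `U(K) → H` takes polynomials in `t` to the same polynomials in `z`; injectivity and
  -- surjectivity are then inherited from the Ore basis.
  have hF : ∀ g, envLift K hK (oreMap f t g) = oreMap (i : UniversalEnvelopingAlgebra k L →ₐ[k] H) z g := by
    have hFf : ∀ a, envLift K hK (f a) = i a := by
      intro a
      have : ((envLift K hK : UniversalEnvelopingAlgebra k K →ₐ[k] H).comp f) = (i : UniversalEnvelopingAlgebra k L →ₐ[k] H) := by
        refine env_hom_ext k fun v => ?_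
        change envLift K hK (f (ι k v)) = i (ι k v)
        rw [hf, envLift_ι]
        rfl
      exact congrArg (fun G : _ →ₐ[k] H => G a) this
    intro g
    induction g using Finsupp.induction_linear with
    | zero => simp
    | add g g' hg hg' => simp only [map_add, hg, hg']
    | single n a =>
      rw [oreMap_single, oreMap_single, map_mul, map_pow, hFf, envLift_ι]
      rfl
  have hbij : Function.Bijective (envLift K hK) := by
    constructor
    · rw [injective_iff_map_eq_zero]
      intro s hs
      obtain ⟨g, rfl⟩ := hsurj s
      rw [hF] at hs
      have : g = 0 := hH.ore.basis.1 (hs.trans (map_zero (oreMap (i : UniversalEnvelopingAlgebra k L →ₐ[k] H) z)).symm)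
      rw [this, map_zero]
    · intro s
      obtain ⟨g, rfl⟩ := hH.ore.basis.2 s
      exact ⟨_, hF g⟩
  refine ⟨K, inferInstance, inferInstance, ?_, ⟨j.range, ?_⟩, ⟨BialgEquiv.ofBijective _ hbij⟩⟩
  · have := (LinearEquiv.ofInjective φ hφinj).finrank_eq
    rw [Module.finrank_prod, hL, Module.finrank_self] at this
    exact this.symm
  · have := (LinearEquiv.ofInjective (j : L →ₗ[k] K) hj).finrank_eq
    rw [hL] at this
    exact this.symm

end OreIsEnveloping

/-! ### Enveloping algebras of three-dimensional Lie algebras -/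

section OreOperators

variable {k : Type u} [Field k] {A : Type v} [Ring A] [Algebra k A]

/-- The twisted Leibniz rule says exactly that the formal operator of left multiplication by `z`
obeys the Ore relation; no ring structure on the polynomials is needed. -/
theorem oreOp_comp_lsmul {τ : A →ₐ[k] A} {δ : A →ₗ[k] A}
    (hδ : ∀ a b, δ (a * b) = τ a * δ b + δ a * b) (a : A) :
    oreOp τ.toLinearMap δ * Algebra.lsmul k k (ℕ →₀ A) a =
      Algebra.lsmul k k (ℕ →₀ A) (τ a) * oreOp τ.toLinearMap δ +
        Algebra.lsmul k k (ℕ →₀ A) (δ a) := by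
  refine Finsupp.lhom_ext fun n b => ?_
  simp only [LinearMap.add_apply, Module.End.mul_apply, Algebra.lsmul_coe, Finsupp.smul_single,
    smul_eq_mul, oreOp_single, hδ, smul_add, AlgHom.toLinearMap_apply, map_mul, Finsupp.single_add]
  abel

end OreOperators

section TwistedDerivation

variable {k : Type u} [Field k] {L : Type v} [LieRing L] [LieAlgebra k L]

/-- The algebra endomorphism `a ↦ ∑ χ(a₁) a₂`. -/
def twistHom (χ : UniversalEnvelopingAlgebra k L →ₐ[k] k) :
    UniversalEnvelopingAlgebra k L →ₐ[k] UniversalEnvelopingAlgebra k L :=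
  (Algebra.TensorProduct.lid k _).toAlgHom.comp
    ((Algebra.TensorProduct.map χ (AlgHom.id k _)).comp (Bialgebra.comulAlgHom k _))

theorem twistHom_toLinearMap (χ : UniversalEnvelopingAlgebra k L →ₐ[k] k) :
    (twistHom χ).toLinearMap = twist χ 1 :=
  LinearMap.ext fun a => (twist_one_apply χ a).symm

theorem twistHom_ι (χ : UniversalEnvelopingAlgebra k L →ₐ[k] k) (v : L) :
    twistHom χ (ι k v) = ι k v + χ (ι k v) • 1 := by
  rw [← twist_one_of_primitive χ (isSkewPrimitive_ι v), ← twistHom_toLinearMap]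
  rfl

/-- A map `d : L → L` with `d([v, w]) = [d(v), w] + [v, d(w)] + χ(v) d(w) - χ(w) d(v)` extends to a
`τ`-derivation of `U(L)`. -/
theorem exists_twisted_derivation (χ : UniversalEnvelopingAlgebra k L →ₐ[k] k) (d : L →ₗ[k] L)
    (hd : ∀ v w : L, d ⁅v, w⁆ = ⁅d v, w⁆ + ⁅v, d w⁆ + χ (ι k v) • d w - χ (ι k w) • d v) :
    ∃ δ : UniversalEnvelopingAlgebra k L →ₗ[k] UniversalEnvelopingAlgebra k L,
      (∀ a b, δ (a * b) = twistHom χ a * δ b + δ a * b) ∧ ∀ v, δ (ι k v) = ι k (d v) := by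
  -- For an algebra map into upper triangular matrices with diagonal `τ`, `id`, multiplicativity of
  -- the corner entry is the `τ`-derivation rule. So `δ` is obtained from the universal property;
  -- the hypothesis on `d` is the bracket condition in the corner.
  let g : L →ₗ⁅k⁆ Matrix (Fin 2) (Fin 2) (UniversalEnvelopingAlgebra k L) :=
    { toFun := fun v => !![twistHom χ (ι k v), ι k (d v); 0, ι k v]
      map_add' := fun v w => by
        ext a b; fin_cases a <;> fin_cases b <;> simp [-UniversalEnvelopingAlgebra.ι_apply]
      map_smul' := fun c v => by
        ext a b; fin_cases a <;> fin_cases b <;> simp [-UniversalEnvelopingAlgebra.ι_apply]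
      map_lie' := fun {v w} => by
        rw [LieRing.of_associative_ring_bracket, hd]
        ext a b
        fin_cases a <;> fin_cases b
        · simp [-UniversalEnvelopingAlgebra.ι_apply, LieRing.of_associative_ring_bracket]
        · simp only [Matrix.sub_apply, Matrix.mul_apply, Fin.sum_univ_two, Fin.zero_eta,
            Fin.mk_one, Matrix.of_apply, Matrix.cons_val_zero, Matrix.cons_val_one,
            Matrix.cons_val', twistHom_ι, map_add, map_sub, map_smul, ← ι_mul_sub, add_mul,
            smul_mul_assoc, one_mul]
          abel
        · simp [-UniversalEnvelopingAlgebra.ι_apply]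
        · simp [-UniversalEnvelopingAlgebra.ι_apply, LieRing.of_associative_ring_bracket] }
  let ρ := UniversalEnvelopingAlgebra.lift k g
  have hρ : ∀ v, ρ (ι k v) = !![twistHom χ (ι k v), ι k (d v); 0, ι k v] := fun v =>
    UniversalEnvelopingAlgebra.lift_ι_apply k g v
  let S : Subalgebra k (UniversalEnvelopingAlgebra k L) :=
    { carrier := {a | ρ a 0 0 = twistHom χ a ∧ ρ a 1 0 = 0 ∧ ρ a 1 1 = a}
      mul_mem' := by
        rintro a b ⟨h1, h2, h3⟩ ⟨h1', h2', h3'⟩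
        simp [Matrix.mul_apply, *]
      add_mem' := by
        rintro a b ⟨h1, h2, h3⟩ ⟨h1', h2', h3'⟩
        simp [*]
      algebraMap_mem' := fun c => by
        simp [Matrix.algebraMap_matrix_apply] }
  have hS : ∀ a, ρ a 0 0 = twistHom χ a ∧ ρ a 1 0 = 0 ∧ ρ a 1 1 = a :=
    mem_of_ι_mem k S fun v => by
      change ρ _ 0 0 = _ ∧ ρ _ 1 0 = 0 ∧ ρ _ 1 1 = _
      rw [hρ]
      exact ⟨rfl, rfl, rfl⟩
  refine ⟨Matrix.entryLinearMap k (UniversalEnvelopingAlgebra k L) 0 1 ∘ₗ ρ.toLinearMap,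
    fun a b => ?_, fun v => ?_⟩
  · simp only [LinearMap.comp_apply, AlgHom.toLinearMap_apply, Matrix.entryLinearMap_apply, map_mul,
      Matrix.mul_apply, Fin.sum_univ_two, (hS a).1, (hS b).2.2]
  · simp only [LinearMap.comp_apply, AlgHom.toLinearMap_apply, Matrix.entryLinearMap_apply, hρ]
    rfl

end TwistedDerivation

section Codimension

variable {k : Type u} [Field k] {M : Type v} [LieRing M] [LieAlgebra k M]

/-- A functional with kernel `N` that is `1` at some element. -/
theorem exists_functional (N : LieSubalgebra k M) (hM : Module.finrank k M = 3)
    (hN : Module.finrank k N = 2) :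
    ∃ (f : M →ₗ[k] k) (m : M), f m = 1 ∧ ∀ t, f t = 0 ↔ t ∈ N := by
  have hfin : Module.Finite k M := Module.finite_of_finrank_pos (by omega)
  have hlt : N.toSubmodule < ⊤ := by
    refine lt_top_iff_ne_top.2 fun htop => ?_
    have h1 : Module.finrank k N.toSubmodule = 2 := hN
    rw [htop, finrank_top, hM] at h1
    omega
  obtain ⟨f, hf, hle⟩ := N.toSubmodule.exists_le_ker_of_lt_top hlt
  obtain ⟨m, hm⟩ : ∃ m, f m ≠ 0 := by
    by_contra! hall
    exact hf (LinearMap.ext hall)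
  have hker : N.toSubmodule = LinearMap.ker f := by
    refine Submodule.eq_of_le_of_finrank_le hle ?_
    have h1 := LinearMap.finrank_range_add_finrank_ker f
    have h2 : 0 < Module.finrank k (LinearMap.range f) := by
      rw [Module.finrank_pos_iff_exists_ne_zero]
      exact ⟨⟨f m, m, rfl⟩, fun h0 => hm (congrArg Subtype.val h0)⟩
    have h3 : Module.finrank k N.toSubmodule = 2 := hN
    omega
  refine ⟨(f m)⁻¹ • f, m, by simp [hm], fun t => ?_⟩
  rw [LinearMap.smul_apply, smul_eq_zero, or_iff_right (inv_ne_zero hm), ← LinearMap.mem_ker,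
    ← hker]
  rfl

/-- Split `M = N + k m`. Since `[m, v] = d(v) + χ(v) m`, the vector `m` plays the role of `z`, and
the Jacobi identity supplies all the conditions on `χ` and `d`. -/
theorem enveloping_isNormalHopfOre (p : ℕ) (N : LieSubalgebra k M) (hM : Module.finrank k M = 3)
    (hN : Module.finrank k N = 2) :
    ∃ (e : Module.Basis (Fin 2) k N)
      (χ : UniversalEnvelopingAlgebra k N →ₐ[k] k)
      (δ : UniversalEnvelopingAlgebra k N →ₗ[k] UniversalEnvelopingAlgebra k N)
      (z : UniversalEnvelopingAlgebra k M),
      IsNormalHopfOre χ 1 1 0 0 δ (envIncl k M N) z ∧ FamilyA p e χ 0 0 δ ∧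
        ∀ v : N, δ (ι k v) ∈ Set.range (ι k (L := N)) := by
  obtain ⟨f, m, hfm, hfN⟩ := exists_functional N hM hN
  have hN0 : ∀ v : N, f v = 0 := fun v => (hfN v).2 v.2
  let P : M →ₗ[k] N := LinearMap.codRestrict N.toSubmodule
    (LinearMap.id - (LinearMap.toSpanSingleton k M m) ∘ₗ f) fun t =>
      (hfN _).1 (by simp [hfm])
  have hP : ∀ t, (P t : M) = t - f t • m := fun t => rfl
  have hdec : ∀ t, t = P t + f t • m := fun t => by rw [hP, sub_add_cancel]
  let χ₀ : N →ₗ[k] k := f ∘ₗ (LieAlgebra.ad k M m : M →ₗ[k] M) ∘ₗ N.toSubmodule.subtype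
  let d : N →ₗ[k] N := P ∘ₗ (LieAlgebra.ad k M m : M →ₗ[k] M) ∘ₗ N.toSubmodule.subtype
  have hm : ∀ v : N, ⁅m, (v : M)⁆ = d v + χ₀ v • m := fun v => hdec ⁅m, (v : M)⁆
  have hm' : ∀ v : N, ⁅(v : M), m⁆ = -(d v + χ₀ v • m) := fun v => by rw [← hm, lie_skew]
  -- Jacobi for `m`, `v`, `w`. Its `m`-component says that `χ₀` kills brackets, so it extends to a
  -- character; its `N`-component says that `d` is a twisted derivation.
  have hjac : ∀ v w : N, (d ⁅v, w⁆ : M) + χ₀ ⁅v, w⁆ • m =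
      ((⁅d v, w⁆ + ⁅v, d w⁆ + χ₀ v • d w - χ₀ w • d v : N) : M) := by
    intro v w
    rw [← hm, LieSubalgebra.coe_bracket, leibniz_lie, hm, hm]
    simp only [add_lie, lie_add, smul_lie, lie_smul, hm, hm',
      AddMemClass.coe_add, AddSubgroupClass.coe_sub, SetLike.val_smul,
      LieSubalgebra.coe_bracket]
    module
  have hχ₀ : ∀ v w : N, χ₀ ⁅v, w⁆ = 0 := fun v w => by
    have := congrArg f (hjac v w)
    rwa [map_add, hN0, hN0, map_smul, hfm, zero_add, smul_eq_mul, mul_one] at this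
  have hd₀ : ∀ v w : N, d ⁅v, w⁆ = ⁅d v, w⁆ + ⁅v, d w⁆ + χ₀ v • d w - χ₀ w • d v := fun v w =>
    Subtype.ext (by
      have := hjac v w
      rwa [hχ₀, zero_smul, add_zero] at this)
  let χ : UniversalEnvelopingAlgebra k N →ₐ[k] k := UniversalEnvelopingAlgebra.lift k
    { χ₀ with
      map_lie' := fun {v w} => by
        change χ₀ ⁅v, w⁆ = ⁅χ₀ v, χ₀ w⁆
        rw [hχ₀, LieRing.of_associative_ring_bracket, mul_comm, sub_self] }
  have hχ : ∀ v, χ (ι k v) = χ₀ v := fun v => UniversalEnvelopingAlgebra.lift_ι_apply k _ v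
  obtain ⟨δ, hδ, hδι⟩ := exists_twisted_derivation χ d (by simpa only [hχ] using hd₀)
  have hδ1 : δ 1 = 0 := by simpa using hδ 1 1
  let I : UniversalEnvelopingAlgebra k N →ₐ[k] UniversalEnvelopingAlgebra k M := envIncl k M N
  have hI : ∀ v : N, I (ι k v) = ι k (v : M) := fun v =>
    UniversalEnvelopingAlgebra.lift_ι_apply k _ v
  have hrel : ∀ a, ι k m * I a = I (twistHom χ a) * ι k m + I (δ a) :=
    relation_of_ι hδ fun v => by
      have h2 := ι_mul_sub (k := k) m (v : M)
      rw [hm, map_add, map_smul, sub_eq_iff_eq_add] at h2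
      rw [twistHom_ι, hδι, map_add, map_smul, map_one, hI, hI, hχ, h2, add_mul, smul_mul_assoc,
        one_mul]
      abel
  -- `U(M)` acts on `U(N)[z]`
  let lm : UniversalEnvelopingAlgebra k N →ₐ[k] Module.End k (ℕ →₀ UniversalEnvelopingAlgebra k N) := Algebra.lsmul k k _
  let Z : Module.End k (ℕ →₀ UniversalEnvelopingAlgebra k N) := oreOp (twistHom χ).toLinearMap δ
  have hZ : ∀ v : N, Z * lm (ι k v) = lm (ι k v) * Z + (χ₀ v • Z + lm (ι k (d v))) := by
    intro v
    have := oreOp_comp_lsmul hδ (ι k v)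
    rw [twistHom_ι, hδι, map_add, map_smul, map_one, hχ, add_mul, smul_mul_assoc, one_mul] at this
    rw [← add_assoc]
    exact this
  let act : M →ₗ[k] Module.End k (ℕ →₀ UniversalEnvelopingAlgebra k N) :=
    lm.toLinearMap ∘ₗ (ι k (L := N)).toLinearMap ∘ₗ P + (LinearMap.toSpanSingleton k _ Z) ∘ₗ f
  have hact : ∀ t, act t = lm (ι k (P t)) + f t • Z := fun t => rfl
  have hactm : act m = Z := by
    have h0 : P m = 0 := Subtype.ext (by rw [hP, hfm, one_smul, sub_self]; rfl)
    rw [hact, h0, hfm, map_zero, map_zero, one_smul, zero_add]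
  have hactN : ∀ v : N, act v = lm (ι k v) := fun v => by
    have h0 : P v = v := Subtype.ext (by rw [hP, hN0, zero_smul, sub_zero])
    rw [hact, h0, hN0, zero_smul, add_zero]
  have hlie : ∀ s t : M, act ⁅s, t⁆ = act s * act t - act t * act s := by
    intro s t
    have h1 : ⁅s, t⁆ = ((⁅P s, P t⁆ + f s • d (P t) - f t • d (P s) : N) : M) +
        (f s * χ₀ (P t) - f t * χ₀ (P s)) • m := by
      conv_lhs => rw [hdec s, hdec t]
      simp only [add_lie, lie_add, smul_lie, lie_smul, lie_self, hm, hm',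
        AddMemClass.coe_add, AddSubgroupClass.coe_sub, SetLike.val_smul,
        LieSubalgebra.coe_bracket]
      module
    rw [h1, map_add, map_smul, hactm, hactN, hact s, hact t]
    simp only [add_mul, mul_add, smul_mul_assoc, mul_smul_comm, hZ, map_add, map_sub, map_smul,
      ← ι_mul_sub, map_mul]
    module
  let Ψ : UniversalEnvelopingAlgebra k M →ₐ[k] Module.End k (ℕ →₀ UniversalEnvelopingAlgebra k N) := UniversalEnvelopingAlgebra.lift k
    { act with map_lie' := fun {s t} => hlie s t }
  have hΨ : ∀ t, Ψ (ι k t) = act t := fun t => UniversalEnvelopingAlgebra.lift_ι_apply k _ t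
  have hΨI : ∀ a, Ψ (I a) = lm a := by
    intro a
    refine mem_of_ι_mem k (AlgHom.equalizer (Ψ.comp I) lm) (fun v => ?_) a
    rw [AlgHom.mem_equalizer]
    change Ψ (I (ι k v)) = _
    rw [hI, hΨ, hactN]
  have hZpow : ∀ n : ℕ, (Z ^ n) (Finsupp.single 0 1) = Finsupp.single n 1 := by
    intro n
    induction n with
    | zero => rfl
    | succ n ih =>
      rw [pow_succ', Module.End.mul_apply, ih]
      change oreOp _ _ _ = _
      rw [oreOp_single, hδ1, Finsupp.single_zero, add_zero, AlgHom.toLinearMap_apply, map_one]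
  -- Acting on the constant polynomial `1` recovers the coefficients of a polynomial in `m`, which
  -- gives uniqueness of the expansion.
  have hΨg : ∀ g : ℕ →₀ UniversalEnvelopingAlgebra k N, Ψ (oreMap I (ι k m) g) (Finsupp.single 0 1) = g := by
    intro g
    induction g using Finsupp.induction_linear with
    | zero => simp
    | add g g' hg hg' => rw [map_add, map_add, LinearMap.add_apply, hg, hg']
    | single n a =>
      rw [oreMap_single, map_mul, map_pow, hΨI, hΨ, hactm, Module.End.mul_apply, hZpow]
      change a • Finsupp.single n 1 = _
      rw [Finsupp.smul_single, smul_eq_mul, mul_one]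
  have hore : IsOreExtension (twistHom χ) δ I (ι k m) := by
    refine ⟨hδ, hrel, fun g g' hgg => ?_, oreMap_surjective (τ := (twistHom χ).toLinearMap) hrel
      fun t => ⟨ι k (P t), f t, ?_⟩⟩
    · have : oreMap I (ι k m) g = oreMap I (ι k m) g' := hgg
      rw [← hΨg g, this, hΨg]
    · change _ = I (ι k (P t)) + _
      rw [hI, ← map_smul, ← map_add, ← hdec]
  obtain ⟨e, he⟩ := exists_isNormalBasis hN
  refine ⟨e, χ, δ, ι k m, ⟨⟨twistHom χ, twistHom_toLinearMap χ, ⟨hore, ?_⟩⟩,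
    IsGroupLikeElem.one, IsGroupLikeElem.one, isSkewPrimitive_zero _ _, isSkewPrimitive_zero _ _,
    Iff.rfl⟩, ⟨he, rfl, rfl, fun v => ?_, ?_⟩, fun v => ⟨d v, (hδι v).symm⟩⟩
  · rw [comul_ι]
    simp [-UniversalEnvelopingAlgebra.ι_apply]
  · rw [hδι]
    exact Submodule.subset_span ⟨d v, 0, by rw [pow_zero, pow_one]⟩
  · simp only [hδι, hd₀, hχ, map_add, map_sub, map_smul, opComm_ι]

end Codimension

end
end HopfOre

namespace HopfOre

noncomputable section

/-! ### Assembling the classification -/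

section Main

variable {k : Type u} [Field k] {L : Type v} [LieRing L] [LieAlgebra k L] {H : Type w} [Ring H]
  [HopfAlgebra k H]
  {τ : UniversalEnvelopingAlgebra k L →ₐ[k] UniversalEnvelopingAlgebra k L}
  {δ : UniversalEnvelopingAlgebra k L →ₗ[k] UniversalEnvelopingAlgebra k L}
  {r₁ r₂ x y : UniversalEnvelopingAlgebra k L} {i : UniversalEnvelopingAlgebra k L →ₐc[k] H} {z : H}

theorem eq_one_of_groupLike_of_finrank (hL : Module.finrank k L = 2)
    (r : UniversalEnvelopingAlgebra k L) (h0 : r ≠ 0)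
    (h : Coalgebra.comul (R := k) r = r ⊗ₜ[k] r) : r = 1 := by
  obtain ⟨e, he⟩ := exists_isNormalBasis hL
  obtain ⟨ε, he⟩ := he.exists_smul
  exact eq_one_of_groupLike e he h0 h

theorem nontrivial_enveloping (hL : Module.finrank k L = 2) :
    Nontrivial (UniversalEnvelopingAlgebra k L) := by
  have : Nontrivial L := Module.nontrivial_of_finrank_pos (R := k) (by omega)
  exact (ι_injective hL).nontrivial

theorem IsSkewPrimitive.existsUnique_pSum {p : ℕ} [CharP k p] (hp : p.Prime)
    {e : Module.Basis (Fin 2) k L} (he : IsNormalBasis e) (hx : IsSkewPrimitive k 1 1 x) :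
    ∃! c : (ℕ →₀ k) × (ℕ →₀ k), x = pSum p (e 0) (e 1) c.1 c.2 := by
  obtain ⟨ε, he⟩ := he.exists_smul
  obtain ⟨α, α', h⟩ := exists_eq_pSum e he hp hx
  refine ⟨(α, α'), h, fun c hc => ?_⟩
  have := pSum_injective e he hp (hc.symm.trans h)
  exact Prod.ext this.1 this.2

/-- For `u = c` one has `Δu - u ⊗ 1 - 1 ⊗ u = -c (1 ⊗ 1)`, so adding the scalar `c` to `z` cancels
`x ⊗ y`. -/
theorem IsGeneralizedHopfOre.classification_of_scalar {p : ℕ} [CharP k p] (hp : p.Prime)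
    (h : IsGeneralizedHopfOre τ δ 1 1 x y i z) {e : Module.Basis (Fin 2) k L}
    (he : IsNormalBasis e) {c : k}
    (hc : x ⊗ₜ[k] y = c • (1 : UniversalEnvelopingAlgebra k L) ⊗ₜ[k] 1) :
    ∃ (χ : UniversalEnvelopingAlgebra k L →ₐ[k] k) (x' y' : UniversalEnvelopingAlgebra k L)
      (δ' : UniversalEnvelopingAlgebra k L →ₗ[k] UniversalEnvelopingAlgebra k L) (z' : H),
      IsNormalHopfOre χ 1 1 x' y' δ' i z' ∧ InList p e χ x' y' δ' := by
  have hs := h.shift (x' := 0) (y' := 0) (c • 1) (by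
    rw [hc, map_smul, Bialgebra.comul_one, Algebra.TensorProduct.one_def,
      TensorProduct.smul_tmul', TensorProduct.tmul_smul, TensorProduct.smul_tmul',
      TensorProduct.tmul_zero, add_zero])
  exact ⟨_, _, _, _, _, hs.isNormalHopfOre (isSkewPrimitive_zero _ _) (isSkewPrimitive_zero _ _)
    Iff.rfl, Or.inl (hs.familyA e hp he)⟩

theorem IsGeneralizedHopfOre.classification {p : ℕ} [CharP k p] (hp : p.Prime) (hp2 : (2 : k) ≠ 0)
    (hL : Module.finrank k L = 2) (h : IsGeneralizedHopfOre τ δ 1 1 x y i z)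
    {e : Module.Basis (Fin 2) k L} (he : IsNormalBasis e) :
    ∃ (χ : UniversalEnvelopingAlgebra k L →ₐ[k] k) (x' y' : UniversalEnvelopingAlgebra k L)
      (δ' : UniversalEnvelopingAlgebra k L →ₗ[k] UniversalEnvelopingAlgebra k L) (z' : H),
      IsNormalHopfOre χ 1 1 x' y' δ' i z' ∧ InList p e χ x' y' δ' := by
  have := nontrivial_enveloping (k := k) hL
  rcases h.primitive_or_scalar (eq_one_of_groupLike_of_finrank hL) with ⟨hx, hy⟩ | hc
  · by_cases hx0 : x = 0
    · exact h.classification_of_scalar hp he (c := 0) (by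
        rw [hx0, TensorProduct.zero_tmul, zero_smul])
    by_cases hy0 : y = 0
    · exact h.classification_of_scalar hp he (c := 0) (by
        rw [hy0, TensorProduct.tmul_zero, zero_smul])
    exact h.classification_of_primitive e hp hp2 he hx hy hx0 hy0
  · obtain ⟨c, hc⟩ := hc
    exact h.classification_of_scalar hp he hc

end Main

end

end HopfOre

theorem proposition2p12 {k : Type u} [Field k] (p : ℕ) [CharP k p] (hp : 2 < p)
    {L : Type v} [LieRing L] [LieAlgebra k L] (hL : Module.finrank k L = 2) :
    -- there is a basis `a, b` with `[a, b] = 0` or `[a, b] = a`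
    (∃ e : Module.Basis (Fin 2) k L, IsNormalBasis e) ∧
    -- every generalized Hopf-Ore extension `H` of `U(L)`
    (∀ {H : Type w} [Ring H] [HopfAlgebra k H]
      (τ : UniversalEnvelopingAlgebra k L →ₐ[k] UniversalEnvelopingAlgebra k L)
      (δ : UniversalEnvelopingAlgebra k L →ₗ[k] UniversalEnvelopingAlgebra k L)
      (r₁ r₂ x y : UniversalEnvelopingAlgebra k L)
      (i : UniversalEnvelopingAlgebra k L →ₐc[k] H) (z : H),
      IsGeneralizedHopfOre τ δ r₁ r₂ x y i z →
        r₁ = 1 ∧ r₂ = 1 ∧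
        -- if `x` and `y` are normalized to be skew-primitive
        (IsSkewPrimitive k 1 r₂ x → IsSkewPrimitive k r₁ 1 y →
          x ∈ hatL p k L ∧ y ∈ hatL p k L ∧
          ∀ e : Module.Basis (Fin 2) k L, IsNormalBasis e →
            (∃! c : (ℕ →₀ k) × (ℕ →₀ k), x = pSum p (e 0) (e 1) c.1 c.2) ∧
            (∃! c : (ℕ →₀ k) × (ℕ →₀ k), y = pSum p (e 0) (e 1) c.1 c.2)) ∧
        -- the classification
        ∀ e : Module.Basis (Fin 2) k L, IsNormalBasis e →
          ∃ (H' : Type w) (_ : Ring H') (_ : HopfAlgebra k H')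
            (χ : UniversalEnvelopingAlgebra k L →ₐ[k] k)
            (x' y' : UniversalEnvelopingAlgebra k L)
            (δ' : UniversalEnvelopingAlgebra k L →ₗ[k] UniversalEnvelopingAlgebra k L)
            (i' : UniversalEnvelopingAlgebra k L →ₐc[k] H') (z' : H'),
            IsNormalHopfOre χ 1 1 x' y' δ' i' z' ∧ InList p e χ x' y' δ' ∧
              ExtensionIso i i') ∧
    -- the members of family (a) with `δ(L) ⊆ L` are enveloping algebras of 3-dimensional Lie
    -- algebras with a 2-dimensional subalgebra
    (∀ {H : Type w} [Ring H] [HopfAlgebra k H] (e : Module.Basis (Fin 2) k L)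
      (χ : UniversalEnvelopingAlgebra k L →ₐ[k] k)
      (δ : UniversalEnvelopingAlgebra k L →ₗ[k] UniversalEnvelopingAlgebra k L)
      (i : UniversalEnvelopingAlgebra k L →ₐc[k] H) (z : H),
      IsNormalHopfOre χ 1 1 0 0 δ i z → FamilyA p e χ 0 0 δ →
      (∀ v : L, δ (UniversalEnvelopingAlgebra.ι k v) ∈
        Set.range (UniversalEnvelopingAlgebra.ι k (L := L))) →
      ∃ (M : Type w) (_ : LieRing M) (_ : LieAlgebra k M),
        Module.finrank k M = 3 ∧ (∃ N : LieSubalgebra k M, Module.finrank k N = 2) ∧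
        Nonempty (UniversalEnvelopingAlgebra k M ≃ₐc[k] H)) ∧
    -- and all of these enveloping algebras arise so
    (∀ {M : Type v} [LieRing M] [LieAlgebra k M] (N : LieSubalgebra k M),
      Module.finrank k M = 3 → Module.finrank k N = 2 →
      ∃ (e : Module.Basis (Fin 2) k N)
        (χ : UniversalEnvelopingAlgebra k N →ₐ[k] k)
        (δ : UniversalEnvelopingAlgebra k N →ₗ[k] UniversalEnvelopingAlgebra k N)
        (z : UniversalEnvelopingAlgebra k M),
        IsNormalHopfOre χ 1 1 0 0 δ (envIncl k M N) z ∧ FamilyA p e χ 0 0 δ ∧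
        ∀ v : N, δ (UniversalEnvelopingAlgebra.ι k v) ∈
          Set.range (UniversalEnvelopingAlgebra.ι k (L := N))) := by
  have hp' : p.Prime := (CharP.char_is_prime_or_zero k p).resolve_right (by omega)
  have hp2 : (2 : k) ≠ 0 := by
    intro h0
    have := (CharP.cast_eq_zero_iff k p 2).1 (by exact_mod_cast h0)
    exact absurd (Nat.le_of_dvd two_pos this) (by omega)
  refine ⟨exists_isNormalBasis hL, ?_, ?_, ?_⟩
  · intro H _ _ τ δ r₁ r₂ x y i z h
    have := nontrivial_enveloping (k := k) hL
    have h1 : r₁ = 1 := eq_one_of_groupLike_of_finrank hL r₁ h.r₁_ne_zero h.comul_r₁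
    have h2 : r₂ = 1 := eq_one_of_groupLike_of_finrank hL r₂ h.r₂_ne_zero h.comul_r₂
    subst h1 h2
    refine ⟨rfl, rfl, fun hx hy => ?_, fun e he => ?_⟩
    · obtain ⟨e, he⟩ := exists_isNormalBasis hL
      obtain ⟨ε, he⟩ := he.exists_smul
      exact ⟨mem_hatL_of_primitive e he hp' hx, mem_hatL_of_primitive e he hp' hy,
        fun e he => ⟨hx.existsUnique_pSum hp' he, hy.existsUnique_pSum hp' he⟩⟩
    · obtain ⟨χ, x', y', δ', z', hn, hlist⟩ := h.classification hp' hp2 hL he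
      -- Only `z` has changed, so the isomorphic extension is `H` itself with the same embedding.
      exact ⟨H, _, _, χ, x', y', δ', i, z', hn, hlist, BialgEquiv.refl k H, by simp⟩
  · intro H _ _ e χ δ i z h _ hδ
    exact exists_enveloping hL h hδ
  · intro M _ _ N hM hN
    exact enveloping_isNormalHopfOre p N hM hN
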